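/- Let $p$ be a prime, $K$ a perfectoid field of residue characteristic $p$, $K^\flat$ its tilt, $\mathcal{O}=\mathcal{O}_K^\flat$ the ring of integers of $K^\flat$, $\mathfrak{m}$ its maximal ideal, $\mathbb{F}=\mathcal{O}/\mathfrak{m}$, and $q=p^f$ with $f\geq 1$. Let $\sigma(x)=x^q$ be the Frobenius of $K^\flat$. Let $|\cdot|$ be an absolute value defining the topology of $K^\flat$ and $\varpi\in K^\flat$ such that $q\,|\varpi^q|=1$ (so $\varpi$ is a nonzero element of $\mathfrak{m}$). A $\varphi$-module over $\mathcal{O}$ is a pair $(M,\varphi)$, where $M$ is a finite free $\mathcal{O}$-module and $\varphi$ is a $\sigma$-semilinear bijection of $M\otimes K^\flat$ onto itself, equivalently a $K^\flat$-linear isomorphism $\varphi^*M\otimes K^\flat\simeq M\otimes K^\flat$. We write $\varphi(\varphi^*M)$ for the $\mathcal{O}$-lattice of $M\otimes K^\flat$ spanned by the image of $M$ under the semilinear map. A strict subobject of $(M,\varphi)$ is a submodule $N\subset M$ with $M/N$ torsion-free such that $N\otimes K^\flat$ is stable under the semilinear bijection and its inverse; then $N$ and $M/N$ are again $\varphi$-modules.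 The length of a torsion module $Q\simeq\bigoplus_i\mathcal{O}/x_i\mathcal{O}$ (a finite sum with all $x_i\neq 0$) is $-\sum_i\log_q|x_i|$, and the degree of $(M,\varphi)$ is $$\deg(M,\varphi)=n\,\mathrm{rank}(M)-\mathrm{length}\left(M/\varpi^{qn}\varphi(\varphi^*M)\right)$$ for any $n\in\mathbb{N}$ with $\varpi^{qn}\varphi(\varphi^*M)\subset M$ (it does not depend on $n$). A $\varphi$-module $X$ is semi-stable of slope $\mu\in\mathbb{R}$ if $\deg X=\mu\,\mathrm{rank}\,X$ and $\deg N\leq\mu\,\mathrm{rank}\,N$ for every strict subobject $N$ of $X$. An $\mathbb{R}$-filtration is a non-increasing, exhaustive, separated and left-continuous family $(\mathcal{F}^\gamma)_{\gamma\in\mathbb{R}}$, where $\mathcal{F}^\gamma_+$ denotes the largest $\mathcal{F}^\eta$ with $\eta>\gamma$. Its type is the sequence $(\gamma_1\geq\cdots\geq\gamma_r)$ in which every $\gamma$ occurs $\mathrm{rank}(\mathcal{F}^\gamma)-\mathrm{rank}(\mathcal{F}^\gamma_+)$ times. The Fargues filtration $\mathcal{F}_F(M,\varphi)$ is the $\mathbb{R}$-filtration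 of $(M,\varphi)$ by strict subobjects such that $\mathcal{F}_F^\gamma/\mathcal{F}_{F,+}^\gamma$ is semi-stable of slope $\gamma$ for all $\gamma\in\mathbb{R}$, and the Fargues type $t_F(M,\varphi)$ is its type. The Hodge type $t_H(M,\varphi)$ is the type of the Hodge filtration of $M\otimes\mathbb{F}=M/\mathfrak{m}M$ by $\mathbb{F}$-subspaces, $$\mathcal{F}_H^\gamma(M,\varphi)=\frac{M\cap I(\gamma)\,\varphi(\varphi^*M)+\mathfrak{m}M}{\mathfrak{m}M},\qquad I(\gamma)=\{x\in K^\flat:|x|\leq q^{-\gamma}\}.$$ Then, for every $\varphi$-module $(M,\varphi)$ over $\mathcal{O}$ of rank $r\in\mathbb{N}$, the Fargues filtration exists and is unique, $\mathcal{F}_H(M,\varphi)$ is an $\mathbb{R}$-filtration, and $$t_F(M,\varphi)\leq t_H(M,\varphi)\quad\text{in }\mathbb{R}^r_\geq ,$$ where $(\gamma_i)\leq(\gamma_i')$ means that $\gamma_1+\cdots+\gamma_s\leq\gamma_1'+\cdots+\gamma_s'$ for $1\leq s\leq r$, with equality for $s=r$. -/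

import Mathlib

open scoped NNReal TensorProduct

noncomputable section

/-! ## Perfectoid fields and their tilts -/

/-- A perfectoid field of residue characteristic `p`: a field which is complete for a non-discrete
non-archimedean absolute value with `‖p‖ < 1`, such that `x ↦ x ^ p` is surjective on
`𝒪_K / p`. -/
class IsPerfectoidField (p : ℕ) (K : Type*) [NormedField K] [IsUltrametricDist K] : Prop where
  complete : CompleteSpace K
  norm_p_lt_one : ‖(p : K)‖ < 1
  nondiscrete : ∀ ε : ℝ, 0 < ε → ∃ x : K, 1 - ε < ‖x‖ ∧ ‖x‖ < 1
  frobenius_surjective :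
    Function.Surjective fun x : ModP (NormedField.valuation (K := K)).integer p => x ^ p

section Tilt

variable (p : ℕ) [Fact p.Prime] (K : Type*) [NormedField K] [IsUltrametricDist K]

/-- The ring of integers `𝒪_K` of a non-archimedean field. -/
abbrev RingOfInt : Type _ := (NormedField.valuation (K := K)).integer

variable [IsPerfectoidField p K]

instance fact_not_isUnit_ringOfInt : Fact (¬ IsUnit (p : RingOfInt K)) := ⟨fun h => by
  have h1 := (Valuation.integer.integers (NormedField.valuation (K := K))).one_of_isUnit h
  have h2 : ‖(p : K)‖₊ = 1 := by simpa using h1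
  have h3 := IsPerfectoidField.norm_p_lt_one (p := p) (K := K)
  rw [← coe_nnnorm, h2] at h3
  simp at h3⟩

instance isDomain_preTilt : IsDomain (PreTilt (RingOfInt K) p) :=
  PreTilt.isDomain K NormedField.valuation (RingOfInt K)
    (Valuation.integer.integers (NormedField.valuation (K := K))) p

/-- The tilt `K^♭`, i.e. the fraction field of the perfection `lim_{x ↦ x ^ p} 𝒪_K / p`. -/
abbrev TiltField : Type _ := FractionRing (PreTilt (RingOfInt K) p)

/-- The valuation on the perfection of `𝒪_K / p`. -/
def preTiltValuation : Valuation (PreTilt (RingOfInt K) p) ℝ≥0 :=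
  PreTilt.val K NormedField.valuation (RingOfInt K)
    (Valuation.integer.integers (NormedField.valuation (K := K))) p

lemma nonZeroDivisors_le_primeCompl :
    nonZeroDivisors (PreTilt (RingOfInt K) p) ≤ (preTiltValuation p K).supp.primeCompl := by
  intro x hx h
  rw [SetLike.mem_coe, Valuation.mem_supp_iff] at h
  exact nonZeroDivisors.ne_zero hx (PreTilt.map_eq_zero
    (Valuation.integer.integers (NormedField.valuation (K := K))) |>.1 h)

/-- The valuation `x ↦ |x^♯|` of the tilt `K^♭`. -/
def tiltValuation : Valuation (TiltField p K) ℝ≥0 :=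
  (preTiltValuation p K).extendToLocalization (nonZeroDivisors_le_primeCompl p K) (TiltField p K)

/-- The ring of integers `𝒪_K^♭` of `K^♭`. -/
abbrev TiltInt : ValuationSubring (TiltField p K) := (tiltValuation p K).valuationSubring

/-- The absolute values of `K^♭` defining its topology are the powers `|-| ^ c`, `c > 0`. -/
def tiltNorm (c : ℝ) (x : TiltField p K) : ℝ := (tiltValuation p K x : ℝ) ^ c

/-- The Frobenius `x ↦ x ^ q` of `K^♭`, for `q = p ^ f`. -/
abbrev tiltFrobenius (f : ℕ) : TiltField p K →+* TiltField p K :=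
  iterateFrobenius (TiltField p K) p f

end Tilt

/-! ## Types and filtrations -/

/-- The order of `ℝ^r_≥`: both sequences are non-increasing, the partial sums of the first one are
bounded by those of the second one, and the total sums are equal. -/
def TypeLE {r : ℕ} (t t' : Fin r → ℝ) : Prop :=
  Antitone t ∧ Antitone t' ∧ (∀ s : Fin r, ∑ i ∈ Finset.Iic s, t i ≤ ∑ i ∈ Finset.Iic s, t' i) ∧
    ∑ i, t i = ∑ i, t' i

/-- `ℝ`-filtrations on a bounded partially ordered set: non-increasing, exhaustive, separated and
left-continuous functions. -/
structure IsRFiltration {P : Type*} [PartialOrder P] [BoundedOrder P] (G : ℝ → P) : Prop where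
  antitone : Antitone G
  exhaustive : ∃ a, ∀ γ ≤ a, G γ = ⊤
  separated : ∃ b, ∀ γ ≥ b, G γ = ⊥
  left_continuous : ∀ γ, ∃ γ' < γ, ∀ η, γ' < η → η ≤ γ → G η = G γ

/-- The type `(t_0 ≥ ⋯ ≥ t_{r-1})` of a filtration `G` with respect to a rank function, where `r`
is the rank of the largest element: `t_i` is the largest `γ` such that `rank (G γ) > i`.
See `card_filtrationType` for its characterisation through multiplicities. -/
def filtrationType {P : Type*} (rank : P → ℕ) (G : ℝ → P) (r : ℕ) (i : Fin r) : ℝ :=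
  sSup {γ : ℝ | (i : ℕ) < rank (G γ)}

lemma le_filtrationType_iff {P : Type*} [PartialOrder P] [BoundedOrder P] {rank : P → ℕ}
    (hrank : Monotone rank) (h0 : rank ⊥ = 0) {G : ℝ → P} (hG : IsRFiltration G)
    (i : Fin (rank ⊤)) (γ : ℝ) :
    γ ≤ filtrationType rank G (rank ⊤) i ↔ (i : ℕ) < rank (G γ) := by
  have hmono : ∀ a b, a ≤ b → (i : ℕ) < rank (G b) → (i : ℕ) < rank (G a) :=
    fun a b hab h => h.trans_le (hrank (hG.antitone hab))
  obtain ⟨b, hb⟩ := hG.separated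
  obtain ⟨a, ha⟩ := hG.exhaustive
  have hbdd : BddAbove {γ : ℝ | (i : ℕ) < rank (G γ)} := by
    refine ⟨b, fun x hx => ?_⟩
    by_contra hlt
    have : (i : ℕ) < rank (G x) := hx
    rw [hb x (not_le.1 hlt).le, h0] at this
    omega
  have hne : {γ : ℝ | (i : ℕ) < rank (G γ)}.Nonempty := ⟨a, by simp [ha a le_rfl]⟩
  refine ⟨fun h => ?_, fun h => le_csSup hbdd h⟩
  obtain ⟨γ', hγ', hc⟩ := hG.left_continuous γ
  obtain ⟨x, hx, hlt⟩ := exists_lt_of_lt_csSup hne (lt_of_lt_of_le hγ' h)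
  rcases le_total x γ with hxγ | hxγ
  · rw [← hc x hlt hxγ]; exact hx
  · exact hmono _ _ hxγ hx

/-- The multiplicity of `γ` in the type of `G` is `rank (G γ) - rank (G₊ γ)`, where `G₊ γ` is the
largest of the `G η` with `η > γ`. -/
lemma card_filtrationType {P : Type*} [PartialOrder P] [BoundedOrder P] {rank : P → ℕ}
    (hrank : Monotone rank) (h0 : rank ⊥ = 0) {G : ℝ → P} (hG : IsRFiltration G)
    (γ : ℝ) (m : P) (hm : IsGreatest (G '' Set.Ioi γ) m) :
    (Finset.univ.filter fun i => filtrationType rank G (rank ⊤) i = γ).card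
      = rank (G γ) - rank m := by
  obtain ⟨⟨η, hη, rfl⟩, hmax⟩ := hm
  have key : ∀ i : Fin (rank ⊤), filtrationType rank G (rank ⊤) i = γ ↔
      rank (G η) ≤ i ∧ (i : ℕ) < rank (G γ) := by
    intro i
    rw [← le_filtrationType_iff hrank h0 hG]
    constructor
    · rintro rfl
      refine ⟨?_, le_rfl⟩
      by_contra hlt
      have := (le_filtrationType_iff hrank h0 hG i η).2 (not_le.1 hlt)
      exact absurd hη (not_lt.2 this)
    · rintro ⟨h1, h2⟩
      refine le_antisymm ?_ h2
      by_contra hlt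
      have h3 := (le_filtrationType_iff hrank h0 hG i _).1 le_rfl
      have h4 := hrank (hmax ⟨_, not_le.1 hlt, rfl⟩)
      omega
  simp_rw [key]
  have hle : rank (G γ) ≤ rank ⊤ := hrank le_top
  have : ((Finset.univ.filter fun i : Fin (rank ⊤) => rank (G η) ≤ i ∧ (i : ℕ) < rank (G γ)).map
      Fin.valEmbedding) = Finset.Ico (rank (G η)) (rank (G γ)) := by
    ext n
    simp only [Finset.mem_map, Finset.mem_filter, Finset.mem_univ, true_and, Finset.mem_Ico,
      Fin.valEmbedding_apply]
    constructor
    · rintro ⟨i, h, rfl⟩; exact h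
    · intro h; exact ⟨⟨n, by omega⟩, h, rfl⟩
  rw [← Finset.card_map Fin.valEmbedding, this, Nat.card_Ico]

/-! ## Length of torsion modules -/

section Length

variable {R F : Type*} [CommRing R] [Field F] [Algebra R F] (q : ℕ) (nrm : F → ℝ)

/-- `Q ≃ R/x_1 ⊕ ⋯ ⊕ R/x_n` with nonzero `x_i`, and `ℓ = - ∑ log_q |x_i|`. -/
def IsLength (Q : Type*) [AddCommGroup Q] [Module R Q] (ℓ : ℝ) : Prop :=
  ∃ (n : ℕ) (x : Fin n → R), (∀ i, x i ≠ 0) ∧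
    Nonempty (Q ≃ₗ[R] ((i : Fin n) → R ⧸ Ideal.span {x i})) ∧
    ℓ = - ∑ i, Real.logb q (nrm (algebraMap R F (x i)))

open Classical in
/-- The length of a finitely presented torsion module over the valuation ring `R`, normalised by
the absolute value `nrm` of `F = Frac R`: the length of `R/x` is `-log_q |x|`. -/
def normLength (Q : Type*) [AddCommGroup Q] [Module R Q] : ℝ :=
  if h : ∃ ℓ, IsLength (R := R) q nrm Q ℓ then h.choose else 0

end Length

/-! ## φ-modules -/

universe uR uF uV

/-- A `φ`-module over `R`, where `F = Frac R` and `σ` is the Frobenius of `F`: an `R`-module `L`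
spanning a vector space `V = L ⊗ F` over `F`, together with a `σ`-semilinear automorphism `φ` of
`V`. A `σ`-semilinear automorphism of `V` is the same as an `F`-linear isomorphism `φ^*V ≃ V`.
Finite freeness of `L` is imposed on the objects we start from; over a valuation ring it then holds
for all their subquotients by strict subobjects. -/
structure PhiModule (R : Type uR) (F : Type uF) [CommRing R] [Field F] [Algebra R F]
    (σ : F →+* F) where
  V : Type uV
  [addCommGroup : AddCommGroup V]
  [moduleF : Module F V]
  [moduleR : Module R V]
  [isScalarTower : IsScalarTower R F V]
  φ : V →ₛₗ[σ] V
  φ_bijective : Function.Bijective φ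
  L : Submodule R V
  span_L : Submodule.span F (L : Set V) = ⊤

namespace PhiModule

attribute [instance] addCommGroup moduleF moduleR isScalarTower

section

variable {R : Type uR} {F : Type uF} [CommRing R] [Field F] [Algebra R F] {σ : F →+* F}

/-- The `φ`-module attached to an `R`-module `M` and a `σ`-semilinear automorphism of `F ⊗ M`. -/
def ofModule (M : Type uV) [AddCommGroup M] [Module R M]
    (φ : F ⊗[R] M →ₛₗ[σ] F ⊗[R] M) (hφ : Function.Bijective φ) :
    PhiModule.{uR, uF, max uF uV} R F σ where
  V := F ⊗[R] M
  φ := φ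
  φ_bijective := hφ
  L := LinearMap.range (TensorProduct.mk R F M 1)
  span_L := by
    rw [eq_top_iff]
    intro x _
    induction x with
    | zero => exact zero_mem _
    | add x y hx hy => exact add_mem (hx trivial) (hy trivial)
    | tmul a m =>
      have : a ⊗ₜ[R] m = a • ((1 : F) ⊗ₜ[R] m) := by simp [TensorProduct.smul_tmul']
      rw [this]
      exact Submodule.smul_mem _ _ (Submodule.subset_span ⟨m, rfl⟩)

variable (X : PhiModule.{uR, uF, uV} R F σ)

/-- The rank of the underlying `R`-module. -/
def rank : ℕ := Module.finrank R X.L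

/-- An `F`-subspace `W` with `φ⁻¹(W) = W`, i.e. `φ(W) = W`. -/
def IsStable (W : Submodule F X.V) : Prop := ∀ x, X.φ x ∈ W ↔ x ∈ W

/-- The strict subobjects of `X`: the `R`-submodules `N` of `L` such that `L/N` is torsion-free and
`N ⊗ F` is `φ`-stable. -/
@[ext]
structure StrictSub where
  N : Submodule R X.V
  le : N ≤ X.L
  saturated : ∀ (a : R) (x : X.V), a ≠ 0 → x ∈ X.L → a • x ∈ N → x ∈ N
  stable : X.IsStable (Submodule.span F (N : Set X.V))

instance : PartialOrder X.StrictSub := PartialOrder.lift StrictSub.N fun _ _ => StrictSub.ext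

lemma isStable_bot : X.IsStable ⊥ := fun x => by
  simp [map_eq_zero_iff X.φ X.φ_bijective.injective]

/-- The `φ`-module `(N, φ)` attached to a strict subobject. -/
def sub (N : X.StrictSub) : PhiModule.{uR, uF, uV} R F σ where
  V := Submodule.span F (N.N : Set X.V)
  φ := (X.φ.domRestrict _).codRestrict _ fun x => (N.stable x).2 x.2
  φ_bijective := by
    refine ⟨fun x y h => Subtype.ext (X.φ_bijective.injective (congrArg Subtype.val h)),
      fun y => ?_⟩
    obtain ⟨x, hx⟩ := X.φ_bijective.surjective y
    exact ⟨⟨x, (N.stable x).1 (hx ▸ y.2)⟩, Subtype.ext hx⟩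
  L := N.N.comap ((Submodule.span F (N.N : Set X.V)).subtype.restrictScalars R)
  span_L := Submodule.span_span_coe_preimage

/-- The quotient of a `φ`-module by a `φ`-stable subspace `U` of `V`: the image of `L` in `V/U`,
with the induced `φ`. -/
def quot (U : Submodule F X.V) (hU : X.IsStable U) : PhiModule.{uR, uF, uV} R F σ where
  V := X.V ⧸ U
  φ := U.mapQ U X.φ fun x hx => (hU x).2 hx
  φ_bijective := by
    constructor
    · rw [injective_iff_map_eq_zero]
      intro x
      obtain ⟨x, rfl⟩ := U.mkQ_surjective x
      intro h
      rw [Submodule.mkQ_apply, Submodule.mapQ_apply, Submodule.Quotient.mk_eq_zero] at h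
      exact (Submodule.Quotient.mk_eq_zero _).2 ((hU x).1 h)
    · intro y
      obtain ⟨y, rfl⟩ := U.mkQ_surjective y
      obtain ⟨x, rfl⟩ := X.φ_bijective.surjective y
      exact ⟨U.mkQ x, rfl⟩
  L := X.L.map (U.mkQ.restrictScalars R)
  span_L := by
    have : ((X.L.map (U.mkQ.restrictScalars R) : Submodule R (X.V ⧸ U)) : Set (X.V ⧸ U))
        = U.mkQ '' (X.L : Set X.V) := rfl
    rw [this, Submodule.span_image, X.span_L, Submodule.map_top, Submodule.range_mkQ]

/-- The subquotient `N/N'` of `X`, for strict subobjects `N' ≤ N`. -/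
def gr (N N' : X.StrictSub) : PhiModule.{uR, uF, uV} R F σ :=
  (X.sub N).quot ((Submodule.span F (N'.N : Set X.V)).submoduleOf
    (Submodule.span F (N.N : Set X.V))) fun x => N'.stable x.1

/-- The `R`-lattice `φ(φ^*L)` of `V`. -/
def frobLattice : Submodule R X.V := Submodule.span R (X.φ '' (X.L : Set X.V))

variable (q : ℕ) (nrm : F → ℝ) (ϖ : F)

/-- The `R`-submodule `ϖ^{qn} φ(φ^*L)` of `V`. -/
def twistedFrobLattice (n : ℕ) : Submodule R X.V :=
  X.frobLattice.map ((LinearMap.lsmul F X.V (ϖ ^ (q * n))).restrictScalars R)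

/-- The degree of `X`: `n rank(L) - length Q^n`, where `Q^n = L / ϖ^{qn} φ(φ^*L)` and `n` is
such that `ϖ^{qn} φ(φ^*L)` is contained in `L`; we choose the smallest such `n ∈ ℕ`. -/
def deg : ℝ :=
  let n := sInf {n : ℕ | X.twistedFrobLattice q ϖ n ≤ X.L}
  n * X.rank - normLength (R := R) q nrm (X.L ⧸ (X.twistedFrobLattice q ϖ n).submoduleOf X.L)

/-- `X` is semi-stable of slope `μ`. -/
def IsSemistable (μ : ℝ) : Prop :=
  X.deg q nrm ϖ = μ * X.rank ∧ ∀ N : X.StrictSub, (X.sub N).deg q nrm ϖ ≤ μ * (X.sub N).rank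

/-- The `R`-submodule `I(γ)` of all `x ∈ F` with `|x| ≤ q^{-γ}` generates `I(γ) L'` inside `V`, for
`L' = φ(φ^*L)`. -/
def ballMulFrobLattice (γ : ℝ) : Submodule R X.V :=
  Submodule.span R {z | ∃ x : F, nrm x ≤ (q : ℝ) ^ (-γ) ∧ ∃ y ∈ X.frobLattice, z = x • y}

/-- The Hodge filtration `γ ↦ (L ∩ I(γ) φ(φ^*L) + 𝔪L)/𝔪L` of `L ⊗ k`: the image of
`L ∩ I(γ) φ(φ^*L)` in `k ⊗ L`, where `k` is the residue field of `R`. -/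
def hodgeFiltration [IsLocalRing R] (γ : ℝ) :
    Submodule (IsLocalRing.ResidueField R) (IsLocalRing.ResidueField R ⊗[R] X.L) :=
  ((X.ballMulFrobLattice q nrm γ).submoduleOf X.L).baseChange (IsLocalRing.ResidueField R)

/-- The Hodge type of `X`. -/
def hodgeType [IsLocalRing R] : Fin X.rank → ℝ :=
  filtrationType (fun W : Submodule (IsLocalRing.ResidueField R) (IsLocalRing.ResidueField R ⊗[R] X.L) =>
      Module.finrank (IsLocalRing.ResidueField R) W)
    (X.hodgeFiltration q nrm) X.rank

end

section Fargues

variable {R : Type uR} {F : Type uF} [CommRing R] [IsDomain R] [Field F] [Algebra R F]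
  [IsFractionRing R F] {σ : F →+* F} (X : PhiModule.{uR, uF, uV} R F σ)

instance : BoundedOrder X.StrictSub where
  top := ⟨X.L, le_rfl, fun _ _ _ hx _ => hx, fun x => by simp [X.span_L]⟩
  le_top N := N.le
  bot := ⟨⊥, bot_le, fun a x ha _ hx => by
    rw [Submodule.mem_bot, ← algebraMap_smul F a x, smul_eq_zero] at hx
    exact hx.resolve_left (by simpa using ha), fun x => by
      have : Submodule.span F (((⊥ : Submodule R X.V)) : Set X.V) = ⊥ := by simp
      rw [this]
      exact X.isStable_bot x⟩
  bot_le N := (bot_le : (⊥ : Submodule R X.V) ≤ N.N)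

variable (q : ℕ) (nrm : F → ℝ) (ϖ : F)

/-- `G` is the Fargues (Harder-Narasimhan) filtration of `X`: an `ℝ`-filtration of `X` by strict
subobjects such that every graded piece `G^γ / G^γ_+`, with `G^γ_+` the largest of the `G^η` for
`η > γ`, is semi-stable of slope `γ`. -/
def IsFarguesFiltration (G : ℝ → X.StrictSub) : Prop :=
  IsRFiltration G ∧ ∀ γ, ∃ N, IsGreatest (G '' Set.Ioi γ) N ∧
    (X.gr (G γ) N).IsSemistable q nrm ϖ γ

open Classical in
/-- The Fargues filtration of `X`. -/
def farguesFiltration : ℝ → X.StrictSub :=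
  if h : ∃ G, X.IsFarguesFiltration q nrm ϖ G then h.choose else fun _ => ⊥

/-- The Fargues type of `X`: the type of its Fargues filtration. -/
def farguesType : Fin X.rank → ℝ :=
  filtrationType (fun N => (X.sub N).rank) (X.farguesFiltration q nrm ϖ) X.rank

end Fargues

end PhiModule

end

/-! The proof separates a lattice-theoretic statement on slopes from linear algebra over a valuation
ring. Strict subobjects correspond to φ-stable subspaces of `V`, so they form a modular lattice of
finite length. The rank is modular on it and the degree turns out to be supermodular.

The degree is `log_q |det A|` for the matrix `A` of φ in any basis of `L` (`PhiModule.deg_eq`). If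
`P` is the matrix of an isogeny from `Y` to `Z`, then `P A = B σ(P)`, hence `|det A| = |det B| |det
P|^(q-1)`, and isogenies can only raise the degree. Block triangular matrices give additivity, and
the isogeny `N/(N ⊓ N') → (N ⊔ N')/N'` then gives supermodularity (`PhiModule.deg_add_deg_le`).

For a bounded supermodular `d`, the function `d - μ rk` has a largest maximiser for every `μ`. These
maximisers form a Harder-Narasimhan filtration (`IsSlopeDatum.isHNFiltration_argmax`), and every
such filtration consists of them (`IsHNFiltration.eq_argmax`). Its type satisfies `∑ max (t_i - γ) 0
= d (G γ) - γ rk (G γ)` (`IsHNFiltration.sum_max_filtrationType`).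

On the Hodge side, elementary divisors give a basis `e_i` of `L` and scalars `l_i` such that the
`l_i e_i` form a basis of `φ(φ^*L)`; the Hodge type is then `log_q |l_i|`. On a strict subobject φ
has a matrix `P diag(l) Q` with `P` and `Q` integral, so by a Cauchy-Binet expansion its determinant
is bounded by a product of distinct `|l_i|`. Thus `deg N - γ rank N ≤ ∑ max (log_q |l_i| - γ) 0`
(`PhiModule.IsHodgeBasis.deg_sub_le`). Taking `N = G γ` for all `γ`, and using that both types sum
to `deg X`, gives the majorisation (`typeLE_of_sum_max_le`). -/

open scoped NNReal TensorProduct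

set_option linter.unusedSectionVars false

/-! ## Harder-Narasimhan filtrations on modular lattices -/

/-- A rank function and a degree function on a bounded lattice: the rank is strictly monotone and
modular, the degree is supermodular and bounded above. -/
structure IsSlopeDatum {P : Type*} [Lattice P] [BoundedOrder P] (rk : P → ℕ) (d : P → ℝ) :
    Prop where
  strictMono : StrictMono rk
  rk_bot : rk ⊥ = 0
  rk_sup_add_rk_inf : ∀ a b, rk (a ⊔ b) + rk (a ⊓ b) = rk a + rk b
  d_bot : d ⊥ = 0
  d_add_le : ∀ a b, d a + d b ≤ d (a ⊔ b) + d (a ⊓ b)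
  bdd : ∃ C, ∀ a, d a ≤ C

/-- A Harder-Narasimhan filtration for a rank and a degree function. -/
def IsHNFiltration {P : Type*} [Lattice P] [BoundedOrder P] (rk : P → ℕ) (d : P → ℝ)
    (G : ℝ → P) : Prop :=
  IsRFiltration G ∧ ∀ γ, ∃ N, IsGreatest (G '' Set.Ioi γ) N ∧
    d (G γ) - d N = γ * (rk (G γ) - rk N) ∧
    ∀ W, N ≤ W → W ≤ G γ → d W - d N ≤ γ * (rk W - rk N)

/-- A non-increasing family in which every value is attained at a largest index. -/
lemma IsRFiltration.exists_last {P : Type*} [PartialOrder P] [BoundedOrder P] {G : ℝ → P}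
    (hG : IsRFiltration G) {γ : ℝ} (h : G γ ≠ ⊥) :
    ∃ γ', γ ≤ γ' ∧ G γ' = G γ ∧ ∀ η, γ' < η → G η ≠ G γ := by
  obtain ⟨b, hb⟩ := hG.separated
  have hbdd : BddAbove {η | G η = G γ} := by
    refine ⟨b, fun x hx => ?_⟩
    by_contra hlt
    exact h (hx ▸ hb x (not_le.1 hlt).le)
  have hne : {η | G η = G γ}.Nonempty := ⟨γ, rfl⟩
  refine ⟨sSup {η | G η = G γ}, le_csSup hbdd rfl, ?_, fun η hη h' => ?_⟩
  · obtain ⟨γ', hγ', hc⟩ := hG.left_continuous (sSup {η | G η = G γ})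
    obtain ⟨x, hx, hlt⟩ := exists_lt_of_lt_csSup hne hγ'
    rw [← hc x hlt (le_csSup hbdd hx)]
    exact hx
  · exact not_lt.2 (le_csSup hbdd h') hη

/-! ### Maximisers of bounded supermodular functions -/

section Supermodular

variable {P : Type*} [Lattice P] [BoundedOrder P] {rk : P → ℕ}

/-- A bounded supermodular function on a lattice of finite length has a maximum. -/
lemma exists_forall_le_of_supermodular (hrk : StrictMono rk) {f : P → ℝ}
    (hf : ∀ a b, f a + f b ≤ f (a ⊔ b) + f (a ⊓ b)) (hb : ∃ C, ∀ a, f a ≤ C) :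
    ∃ x, ∀ y, f y ≤ f x := by
  obtain ⟨C, hC⟩ := hb
  have hbdd : BddAbove (Set.range f) := ⟨C, by rintro _ ⟨x, rfl⟩; exact hC x⟩
  have hle : ∀ x, f x ≤ sSup (Set.range f) := fun x => le_csSup hbdd ⟨x, rfl⟩
  set s := sSup (Set.range f) with hs
  -- The lattice may be infinite, so attaining the supremum needs an argument. Take the largest `k`
  -- such that elements of rank at least `k` approach `s`; elements of rank above `k` then stay
  -- below `s` by a fixed `ε`.
  let A : ℕ → Prop := fun k => ∀ ε > 0, ∃ x, k ≤ rk x ∧ s - ε < f x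
  have hA0 : A 0 := fun ε hε => by
    obtain ⟨_, ⟨x, rfl⟩, hx⟩ := exists_lt_of_lt_csSup (Set.range_nonempty f)
      (show s - ε < sSup (Set.range f) by linarith)
    exact ⟨x, Nat.zero_le _, hx⟩
  have hAn : ¬ A (rk ⊤ + 1) := fun h => by
    obtain ⟨x, hx, -⟩ := h 1 one_pos
    have := hrk.monotone (le_top : x ≤ ⊤)
    omega
  obtain ⟨k, hk, hk'⟩ : ∃ k, A k ∧ ¬ A (k + 1) := by
    by_contra! h
    exact hAn (Nat.rec (motive := A) hA0 (fun k hk => h k hk) _)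
  simp only [A, not_forall, not_exists, not_and, not_lt] at hk'
  obtain ⟨ε, hε, hlow⟩ := hk'
  -- As `f (x ⊓ y) ≤ s`, supermodularity forces `f (x ⊔ y) > s - ε`, so the join has rank at most
  -- `k` and equals `x`. Hence a single element approaches the supremum, and so attains it.
  have huniq : ∀ x y, k ≤ rk x → k ≤ rk y → s - ε / 2 < f x → s - ε / 2 < f y → y = x := by
    have key : ∀ x y, k ≤ rk x → s - ε / 2 < f x → s - ε / 2 < f y → y ≤ x := by
      intro x y hx hfx hfy
      have h1 := hf x y
      have h2 := hle (x ⊓ y)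
      have h3 : rk (x ⊔ y) ≤ rk x := by
        by_contra hlt
        have := hlow (x ⊔ y) (by omega)
        linarith
      have h4 : x = x ⊔ y := by
        by_contra hne
        exact absurd (hrk (lt_of_le_of_ne le_sup_left hne)) (not_lt.2 h3)
      rw [h4]
      exact le_sup_right
    exact fun x y hx hy hfx hfy => le_antisymm (key x y hx hfx hfy) (key y x hy hfy hfx)
  obtain ⟨x, hx, hfx⟩ := hk (ε / 2) (by linarith)
  have hmax : s ≤ f x := by
    refine le_of_forall_pos_lt_add fun δ hδ => ?_
    obtain ⟨y, hy, hfy⟩ := hk (min δ (ε / 2)) (lt_min hδ (by linarith))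
    have h1 := min_le_left δ (ε / 2)
    have h2 := min_le_right δ (ε / 2)
    rw [huniq x y hx hy hfx (by linarith)] at hfy
    linarith
  exact ⟨x, fun y => (hle y).trans hmax⟩

/-- A bounded supermodular function on a lattice of finite length has a largest maximum. -/
lemma exists_isGreatest_forall_le (hrk : StrictMono rk) {f : P → ℝ}
    (hf : ∀ a b, f a + f b ≤ f (a ⊔ b) + f (a ⊓ b)) (hb : ∃ C, ∀ a, f a ≤ C) :
    ∃ x, IsGreatest {x | ∀ y, f y ≤ f x} x := by
  obtain ⟨x₀, hx₀⟩ := exists_forall_le_of_supermodular hrk hf hb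
  have hbd : BddAbove (rk '' {x | ∀ y, f y ≤ f x}) :=
    ⟨rk ⊤, by rintro _ ⟨x, -, rfl⟩; exact hrk.monotone le_top⟩
  obtain ⟨x, hx, hxk⟩ := Nat.sSup_mem (Set.Nonempty.image rk (s := {x | ∀ y, f y ≤ f x}) ⟨x₀, hx₀⟩) hbd
  refine ⟨x, hx, fun z hz => ?_⟩
  -- Joins of maximisers are maximisers, so one of largest rank dominates all others.
  have h1 : x ⊔ z ∈ {x | ∀ y, f y ≤ f x} := fun y => by
    have := hf x z
    have h2 := hx (x ⊓ z)
    have h3 := hz y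
    linarith
  have h2 : rk (x ⊔ z) ≤ rk x := hxk ▸ le_csSup hbd ⟨_, h1, rfl⟩
  have h4 : x = x ⊔ z := by
    by_contra hne
    exact absurd (hrk (lt_of_le_of_ne le_sup_left hne)) (not_lt.2 h2)
  rw [h4]
  exact le_sup_right

end Supermodular

/-- An element which maximises `d - η rk` for `η` arbitrarily close to `γ` maximises
`d - γ rk`. -/
lemma forall_sub_mul_le_of_mem_closure {P : Type*} {rk : P → ℕ} {d : P → ℝ} {x : P} {γ : ℝ} {s : Set ℝ} (hs : γ ∈ closure s)
    (hx : ∀ η ∈ s, ∀ y, d y - η * rk y ≤ d x - η * rk x) (y : P) :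
    d y - γ * rk y ≤ d x - γ * rk x := by
  have hcl : IsClosed {η : ℝ | d y - η * rk y ≤ d x - η * rk x} :=
    isClosed_le (by fun_prop) (by fun_prop)
  exact hcl.closure_subset_iff.2 (fun η hη => hx η hη y) hs

/-! ### Existence of Harder-Narasimhan filtrations -/

namespace IsSlopeDatum

variable {P : Type*} [Lattice P] [BoundedOrder P] {rk : P → ℕ} {d : P → ℝ}

lemma eq_of_le_of_rk_le (h : IsSlopeDatum rk d) {a b : P} (hab : a ≤ b) (hr : rk b ≤ rk a) :
    a = b := by
  by_contra hne
  exact absurd (h.strictMono (lt_of_le_of_ne hab hne)) (not_lt.2 hr)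

lemma rk_sup_add_rk_inf_cast (h : IsSlopeDatum rk d) (a b : P) :
    (rk (a ⊔ b) : ℝ) + rk (a ⊓ b) = rk a + rk b := by
  exact_mod_cast h.rk_sup_add_rk_inf a b

/-- Modularity of the rank keeps `d - μ rk` supermodular for either sign of `μ`, and the bound `rk ≤
rk ⊤` keeps it bounded above. -/
lemma exists_isGreatest_argmax (h : IsSlopeDatum rk d) (μ : ℝ) :
    ∃ x, IsGreatest {x | ∀ y, d y - μ * rk y ≤ d x - μ * rk x} x := by
  refine exists_isGreatest_forall_le h.strictMono (f := fun y => d y - μ * rk y)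
    (fun a b => ?_) ?_
  · have h1 := h.d_add_le a b
    have h2 : μ * (rk (a ⊔ b) + rk (a ⊓ b)) = μ * (rk a + rk b) := by
      rw [h.rk_sup_add_rk_inf_cast]
    linarith
  · obtain ⟨C, hC⟩ := h.bdd
    refine ⟨C + |μ| * rk ⊤, fun a => ?_⟩
    have h1 : (rk a : ℝ) ≤ rk ⊤ := by exact_mod_cast h.strictMono.monotone le_top
    have h2 : -μ * rk a ≤ |μ| * rk ⊤ :=
      mul_le_mul (neg_le_abs μ) h1 (Nat.cast_nonneg _) (abs_nonneg _)
    have := hC a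
    linarith

/-- The largest maximum of `d - μ rk`. -/
noncomputable def argmax (h : IsSlopeDatum rk d) (μ : ℝ) : P :=
  (h.exists_isGreatest_argmax μ).choose

lemma le_argmax (h : IsSlopeDatum rk d) (μ : ℝ) (y : P) :
    d y - μ * rk y ≤ d (h.argmax μ) - μ * rk (h.argmax μ) :=
  (h.exists_isGreatest_argmax μ).choose_spec.1 y

lemma argmax_max (h : IsSlopeDatum rk d) (μ : ℝ) (x : P)
    (hx : ∀ y, d y - μ * rk y ≤ d x - μ * rk x) : x ≤ h.argmax μ :=
  (h.exists_isGreatest_argmax μ).choose_spec.2 hx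

/-- Exchange argument for `μ < ν`: test the maximiser `a` for `ν` against `a ⊓ b` and the maximiser
`b` for `μ` against `a ⊔ b`. Supermodularity leaves `(ν - μ)(rk a - rk (a ⊓ b)) ≤ 0`, so `a ⊓ b =
a`. -/
lemma antitone_argmax (h : IsSlopeDatum rk d) : Antitone h.argmax := by
  intro μ ν hμν
  rcases hμν.eq_or_lt with rfl | hlt
  · exact le_rfl
  set a := h.argmax ν
  set b := h.argmax μ
  have h1 := h.le_argmax ν (a ⊓ b)
  have h2 := h.le_argmax μ (a ⊔ b)
  have h3 := h.d_add_le a b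
  have h4 := h.rk_sup_add_rk_inf_cast a b
  have h5 : (rk (a ⊔ b) : ℝ) = rk a + rk b - rk (a ⊓ b) := by linarith
  rw [h5] at h2
  have h6 : (ν - μ) * ((rk a : ℝ) - rk (a ⊓ b)) ≤ 0 := by
    change d (a ⊓ b) - ν * rk (a ⊓ b) ≤ d a - ν * rk a at h1
    change _ ≤ d b - μ * rk b at h2
    linarith
  have h7 : rk a ≤ rk (a ⊓ b) := by
    by_contra hh
    have : (0 : ℝ) < (rk a : ℝ) - rk (a ⊓ b) := by
      rw [sub_pos]; exact_mod_cast not_le.1 hh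
    have := mul_pos (sub_pos.2 hlt) this
    linarith
  rw [← h.eq_of_le_of_rk_le inf_le_left h7]
  exact inf_le_right

/-- On one side of `γ`, `argmax` is constant near `γ`. -/
lemma exists_argmax_eq_left (h : IsSlopeDatum rk d) (γ : ℝ) :
    ∃ γ' < γ, ∀ η, γ' < η → η < γ → h.argmax η = h.argmax ((γ' + γ) / 2) := by
  have hne : (rk '' (h.argmax '' Set.Iio γ)).Nonempty :=
    ⟨_, _, ⟨γ - 1, by simp, rfl⟩, rfl⟩
  obtain ⟨_, ⟨a, ha, rfl⟩, hk⟩ := Nat.sInf_mem hne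
  rw [Set.mem_Iio] at ha
  have key : ∀ η, a < η → η < γ → h.argmax η = h.argmax a := fun η h1 h2 =>
    h.eq_of_le_of_rk_le (h.antitone_argmax h1.le) (hk ▸ Nat.sInf_le ⟨_, ⟨η, h2, rfl⟩, rfl⟩)
  exact ⟨a, ha, fun η h1 h2 => by
    rw [key η h1 h2, key ((a + γ) / 2) (by linarith) (by linarith)]⟩

/-- The antitone family is constant from `γ` (excluded) up to an index where the rank is largest on
`(γ, ∞)`. This value is the successor `G₊ γ`. -/
lemma exists_argmax_eq_right (h : IsSlopeDatum rk d) (γ : ℝ) :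
    ∃ γ' > γ, ∀ η, γ < η → η ≤ γ' → h.argmax η = h.argmax γ' := by
  have hne : (rk '' (h.argmax '' Set.Ioi γ)).Nonempty :=
    ⟨_, _, ⟨γ + 1, by simp, rfl⟩, rfl⟩
  have hbd : BddAbove (rk '' (h.argmax '' Set.Ioi γ)) :=
    ⟨rk ⊤, by rintro _ ⟨x, -, rfl⟩; exact h.strictMono.monotone le_top⟩
  obtain ⟨_, ⟨a, ha, rfl⟩, hk⟩ := Nat.sSup_mem hne hbd
  exact ⟨a, ha, fun η h1 h2 => (h.eq_of_le_of_rk_le (h.antitone_argmax h2)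
    (hk ▸ le_csSup hbd ⟨_, ⟨η, h1, rfl⟩, rfl⟩)).symm⟩

lemma isRFiltration_argmax (h : IsSlopeDatum rk d) : IsRFiltration h.argmax where
  antitone := h.antitone_argmax
  exhaustive := by
    obtain ⟨C, hC⟩ := h.bdd
    -- If the maximiser had rank below `rk ⊤`, comparison with `⊤` at `γ ≤ 0` would give `d ⊤ - γ ≤
    -- C`.
    refine ⟨min (d ⊤ - C - 1) 0, fun γ hγ => h.eq_of_le_of_rk_le le_top ?_⟩
    have h1 := h.le_argmax γ ⊤
    have h2 := hC (h.argmax γ)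
    have h3 : γ ≤ d ⊤ - C - 1 := hγ.trans (min_le_left _ _)
    have h4 : γ ≤ 0 := hγ.trans (min_le_right _ _)
    by_contra hlt
    have h5 : (rk (h.argmax γ) : ℝ) + 1 ≤ rk ⊤ := by exact_mod_cast not_le.1 hlt
    nlinarith [mul_nonneg (neg_nonneg.2 h4) (sub_nonneg.2 h5)]
  separated := by
    obtain ⟨C, hC⟩ := h.bdd
    refine ⟨max (C + 1) 0, fun γ hγ => (h.eq_of_le_of_rk_le bot_le ?_).symm⟩
    have h1 := h.le_argmax γ ⊥
    rw [h.rk_bot, h.d_bot, Nat.cast_zero, mul_zero] at h1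
    have h2 := hC (h.argmax γ)
    have h3 : C + 1 ≤ γ := (le_max_left _ _).trans hγ
    have h4 : 0 ≤ γ := (le_max_right _ _).trans hγ
    rw [h.rk_bot]
    by_contra hlt
    have h5 : (1 : ℝ) ≤ rk (h.argmax γ) := by exact_mod_cast not_le.1 hlt
    nlinarith [mul_le_mul_of_nonneg_left h5 h4]
  left_continuous := by
    intro γ
    obtain ⟨γ', hγ', hc⟩ := h.exists_argmax_eq_left γ
    refine ⟨γ', hγ', fun η h1 h2 => ?_⟩
    rcases h2.eq_or_lt with rfl | h2
    · rfl
    -- The constant value on `(γ', γ)` maximises for all these slopes, hence also at the endpoint;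
    -- it lies below the largest maximiser there.
    refine le_antisymm (h.argmax_max γ _ (forall_sub_mul_le_of_mem_closure (s := Set.Ioo γ' γ) ?_ ?_))
      (h.antitone_argmax h2.le)
    · rw [closure_Ioo hγ'.ne]
      exact ⟨hγ'.le, le_rfl⟩
    · intro ξ hξ y
      rw [hc η h1 h2, ← hc ξ hξ.1 hξ.2]
      exact h.le_argmax ξ y

/-- The value just to the right of `γ` still maximises `d - γ rk`, by passing to the limit. Equality
of the two maxima gives the slope of the graded piece, and maximality of the smaller one gives
semi-stability. -/
lemma isHNFiltration_argmax (h : IsSlopeDatum rk d) : IsHNFiltration rk d h.argmax := by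
  refine ⟨h.isRFiltration_argmax, fun γ => ?_⟩
  obtain ⟨γ', hγ', hc⟩ := h.exists_argmax_eq_right γ
  have hmax : ∀ y, d y - γ * rk y ≤ d (h.argmax γ') - γ * rk (h.argmax γ') := by
    refine forall_sub_mul_le_of_mem_closure (s := Set.Ioo γ γ') ?_ ?_
    · rw [closure_Ioo hγ'.ne]
      exact ⟨le_rfl, hγ'.le⟩
    · intro ξ hξ y
      rw [← hc ξ hξ.1 hξ.2.le]
      exact h.le_argmax ξ y
  refine ⟨h.argmax γ', ⟨⟨γ', hγ', rfl⟩, ?_⟩, ?_, fun W _ _ => ?_⟩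
  · rintro _ ⟨η, hη, rfl⟩
    rcases le_total η γ' with h1 | h1
    · exact (hc η hη h1).le
    · exact h.antitone_argmax h1
  · linarith [hmax (h.argmax γ), h.le_argmax γ (h.argmax γ')]
  · linarith [hmax W]

end IsSlopeDatum

/-! ### Uniqueness and polygon of Harder-Narasimhan filtrations -/

namespace IsHNFiltration

variable {P : Type*} [Lattice P] [BoundedOrder P] {rk : P → ℕ} {d : P → ℝ} {G : ℝ → P}

/-- Descending induction along the jumps of a Harder-Narasimhan filtration. -/
lemma jump_induction (h : IsSlopeDatum rk d) (hG : IsHNFiltration rk d G) {p : P → Prop}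
    {a b : ℝ} (hbase : p (G b))
    (hstep : ∀ γ, a ≤ γ → γ < b → ∀ N, N ≤ G γ → IsGreatest (G '' Set.Ioi γ) N →
      d (G γ) - d N = γ * (rk (G γ) - rk N) →
      (∀ W, N ≤ W → W ≤ G γ → d W - d N ≤ γ * (rk W - rk N)) → p N → p (G γ)) :
    ∀ γ, a ≤ γ → γ ≤ b → p (G γ) := by
  have key : ∀ n : ℕ, ∀ γ, a ≤ γ → γ ≤ b → rk (G γ) = n → p (G γ) := by
    intro n
    induction n using Nat.strong_induction_on with
    | _ n ih =>
      intro γ ha hγ hn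
      by_cases hb : G γ = G b
      · rwa [hb]
      have hne : G γ ≠ ⊥ := fun hb' => hb (hb'.trans
        (le_bot_iff.1 (hb' ▸ hG.1.antitone hγ)).symm)
      -- Only at the last index with the value `G γ` is the successor strictly smaller, which makes
      -- the induction on the rank decrease.
      obtain ⟨γ', h1, h2, h3⟩ := hG.1.exists_last hne
      have h4 : γ' < b := by
        by_contra hh
        exact hb (le_antisymm (h2 ▸ hG.1.antitone (not_lt.1 hh)) (hG.1.antitone hγ))
      obtain ⟨N, hN, h5, h6⟩ := hG.2 γ'
      obtain ⟨η, hη, rfl⟩ := hN.1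
      rw [Set.mem_Ioi] at hη
      -- The index of the successor may exceed `b`; maximality among later steps lets it be
      -- truncated at `b`, within the range of the induction.
      have h7 : G (min η b) = G η := le_antisymm (hN.2 ⟨_, lt_min hη h4, rfl⟩)
        (hG.1.antitone (min_le_left _ _))
      have h8 : rk (G η) < rk (G γ) := h.strictMono
        (lt_of_le_of_ne (h2 ▸ hG.1.antitone hη.le) (h3 η hη))
      rw [← h2]
      refine hstep γ' (ha.trans h1) h4 (G η) (hG.1.antitone hη.le) hN h5 h6 ?_
      rw [← h7]
      exact ih _ (by rw [← hn, h7]; exact h8) _ (le_min (by linarith) (by linarith))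
        (min_le_right _ _) rfl
  exact fun γ ha hγ => key _ γ ha hγ rfl

/-- The comparison of `W` with a semi-stable step `N ≤ M` of slope `γ`. -/
lemma inf_step (h : IsSlopeDatum rk d) {γ : ℝ} {M N : P} (hNM : N ≤ M)
    (hs : ∀ W, N ≤ W → W ≤ M → d W - d N ≤ γ * (rk W - rk N)) (W : P) :
    d (W ⊓ M) - d (W ⊓ N) ≤ γ * (rk (W ⊓ M) - rk (W ⊓ N)) ∧
      (rk (W ⊓ M) : ℝ) - rk (W ⊓ N) ≤ rk M - rk N := by
  have h1 := h.d_add_le (W ⊓ M) N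
  have h2 := h.rk_sup_add_rk_inf_cast (W ⊓ M) N
  have h3 : W ⊓ M ⊓ N = W ⊓ N := by rw [inf_assoc, inf_eq_right.2 hNM]
  rw [h3] at h1 h2
  -- Semi-stability applies to `W ⊓ M ⊔ N`, which has the same rank over `N` as `W ⊓ M` has over `W
  -- ⊓ N`; supermodularity compares the degrees.
  have h4 := hs (W ⊓ M ⊔ N) le_sup_right (sup_le inf_le_right hNM)
  have h5 : (rk (W ⊓ M ⊔ N) : ℝ) - rk N = rk (W ⊓ M) - rk (W ⊓ N) := by linarith
  rw [h5] at h4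
  have h8 : (rk (W ⊓ M ⊔ N) : ℝ) ≤ rk M := by
    exact_mod_cast h.strictMono.monotone (sup_le inf_le_right hNM)
  exact ⟨by linarith, by linarith⟩

/-- All jumps inside `G μ` have slope `γ ≥ μ`. There the full step gains `(γ - μ)` times its rank,
while the trace of `W` gains at most `(γ - μ)` times a smaller rank. -/
lemma inf_le (h : IsSlopeDatum rk d) (hG : IsHNFiltration rk d G) (μ : ℝ) (W : P) :
    d (W ⊓ G μ) - μ * rk (W ⊓ G μ) ≤ d (G μ) - μ * rk (G μ) := by
  obtain ⟨b, hb⟩ := hG.1.separated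
  refine hG.jump_induction h (p := fun x => d (W ⊓ x) - μ * rk (W ⊓ x) ≤ d x - μ * rk x)
    (a := μ) (b := max b μ) ?_ ?_ μ le_rfl (le_max_right _ _)
  · rw [hb _ (le_max_left _ _), inf_bot_eq]
  · intro γ hγ _ N hN _ h1 h2 ih
    obtain ⟨h3, h4⟩ := inf_step h hN h2 W
    have h5 := mul_le_mul_of_nonneg_left h4 (sub_nonneg.2 hγ)
    linarith

/-- Beyond `G μ` the jumps have slope `γ < μ`, so each step that enlarges the trace of `W` strictly
lowers `d - μ rk`. -/
lemma lt_inf_or_eq_inf (h : IsSlopeDatum rk d) (hG : IsHNFiltration rk d G) (μ : ℝ) (W : P) :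
    d W - μ * rk W < d (W ⊓ G μ) - μ * rk (W ⊓ G μ) ∨ W = W ⊓ G μ := by
  obtain ⟨a, ha⟩ := hG.1.exhaustive
  have := hG.jump_induction h (p := fun x =>
      d (W ⊓ x) - μ * rk (W ⊓ x) < d (W ⊓ G μ) - μ * rk (W ⊓ G μ) ∨ W ⊓ x = W ⊓ G μ)
    (a := min a μ) (b := μ) (Or.inr rfl) ?_ (min a μ) le_rfl (min_le_right _ _)
  · rwa [ha _ (min_le_left _ _), inf_top_eq] at this
  · intro γ _ hγ N hN _ h1 h2 ih
    obtain ⟨h3, -⟩ := inf_step h hN h2 W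
    by_cases heq : W ⊓ N = W ⊓ G γ
    · rwa [heq] at ih
    have h4 : (rk (W ⊓ N) : ℝ) < rk (W ⊓ G γ) := by
      exact_mod_cast h.strictMono (lt_of_le_of_ne (inf_le_inf_left W hN) heq)
    have h5 := mul_lt_mul_of_pos_right hγ (sub_pos.2 h4)
    left
    rcases ih with ih | ih
    · linarith
    · rw [ih] at h3 h5
      linarith

/-- `inf_le` and `lt_inf_or_eq_inf` together make `G μ` a maximiser of `d - μ rk` and force every
other maximiser inside it. This characterises `G μ` without reference to the filtration. -/
theorem eq_argmax (h : IsSlopeDatum rk d) (hG : IsHNFiltration rk d G) : G = h.argmax := by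
  ext1 μ
  have hmax : ∀ W, d W - μ * rk W ≤ d (G μ) - μ * rk (G μ) := fun W => by
    have h1 := hG.inf_le h μ W
    rcases hG.lt_inf_or_eq_inf h μ W with h2 | h2
    · linarith
    · rwa [← h2] at h1
  refine le_antisymm (h.argmax_max μ _ hmax) ?_
  rcases hG.lt_inf_or_eq_inf h μ (h.argmax μ) with h2 | h2
  · linarith [h.le_argmax μ (h.argmax μ ⊓ G μ)]
  · rw [h2]
    exact inf_le_right

open Finset in
/-- The values of the type of a Harder-Narasimhan filtration which belong to a step sum to the
degree of that step. -/
theorem sum_filtrationType (h : IsSlopeDatum rk d) (hG : IsHNFiltration rk d G) (γ : ℝ) :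
    ∑ i ∈ univ.filter fun i : Fin (rk ⊤) => (i : ℕ) < rk (G γ), filtrationType rk G (rk ⊤) i = d (G γ) := by
  obtain ⟨b, hb⟩ := hG.1.separated
  refine hG.jump_induction h
    (p := fun x => ∑ i ∈ univ.filter fun i : Fin (rk ⊤) => (i : ℕ) < rk x, filtrationType rk G (rk ⊤) i = d x)
    (a := γ) (b := max b γ) ?_ ?_ γ le_rfl (le_max_right _ _)
  · rw [hb _ (le_max_left _ _), h.rk_bot, h.d_bot]
    simp
  · intro γ _ _ N hN hgr h1 h2 ih
    have hle : rk N ≤ rk (G γ) := h.strictMono.monotone hN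
    have hconst : ∀ i : Fin (rk ⊤), filtrationType rk G (rk ⊤) i = γ ↔
        rk N ≤ i ∧ (i : ℕ) < rk (G γ) := by
      have hiff := le_filtrationType_iff h.strictMono.monotone h.rk_bot hG.1
      obtain ⟨⟨η, hη, rfl⟩, hmax⟩ := hgr
      intro i
      rw [← hiff]
      constructor
      · rintro rfl
        refine ⟨?_, le_rfl⟩
        by_contra hlt
        exact absurd hη (not_lt.2 ((hiff i η).2 (not_le.1 hlt)))
      · rintro ⟨h1, h2⟩
        refine le_antisymm ?_ h2
        by_contra hlt
        have h3 := (hiff i _).1 le_rfl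
        have h4 := h.strictMono.monotone (hmax ⟨_, not_le.1 hlt, rfl⟩)
        omega
    have hcard := card_filtrationType h.strictMono.monotone h.rk_bot hG.1 γ N hgr
    -- The new indices are exactly those of value `γ`. Their number is the rank of the graded piece,
    -- so they contribute its degree.
    have hsplit : (univ.filter fun i : Fin (rk ⊤) => (i : ℕ) < rk (G γ)) =
        (univ.filter fun i : Fin (rk ⊤) => (i : ℕ) < rk N) ∪
        (univ.filter fun i : Fin (rk ⊤) => filtrationType rk G (rk ⊤) i = γ) := by
      ext i
      simp only [mem_filter, mem_univ, true_and, mem_union, hconst]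
      omega
    rw [hsplit, sum_union, ih, sum_congr rfl (g := fun _ => γ) (fun i hi => (mem_filter.1 hi).2),
      sum_const, hcard, nsmul_eq_mul, Nat.cast_sub hle]
    · linarith
    · rw [disjoint_left]
      intro i hi hi'
      simp only [mem_filter, mem_univ, true_and, hconst] at hi hi'
      omega

-- The indices with `t_i ≥ γ` are the first `rk (G γ)` ones. The left side is the Legendre transform
-- of the polygon, a form in which upper bounds for degrees apply directly.
open Finset in
theorem sum_max_filtrationType (h : IsSlopeDatum rk d) (hG : IsHNFiltration rk d G) (γ : ℝ) :
    ∑ i : Fin (rk ⊤), max (filtrationType rk G (rk ⊤) i - γ) 0 =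
      d (G γ) - γ * rk (G γ) := by
  have hiff := le_filtrationType_iff h.strictMono.monotone h.rk_bot hG.1
  rw [← hG.sum_filtrationType h γ, ← sum_filter_add_sum_filter_not univ
    (fun i : Fin (rk ⊤) => (i : ℕ) < rk (G γ))]
  have h1 : ∑ i ∈ univ.filter fun i : Fin (rk ⊤) => (i : ℕ) < rk (G γ),
      max (filtrationType rk G (rk ⊤) i - γ) 0 =
      ∑ i ∈ univ.filter fun i : Fin (rk ⊤) => (i : ℕ) < rk (G γ), (filtrationType rk G (rk ⊤) i - γ) :=
    sum_congr rfl fun i hi => max_eq_left (sub_nonneg.2 ((hiff i γ).2 (mem_filter.1 hi).2))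
  have h2 : ∑ i ∈ univ.filter fun i : Fin (rk ⊤) => ¬ (i : ℕ) < rk (G γ),
      max (filtrationType rk G (rk ⊤) i - γ) 0 = 0 :=
    sum_eq_zero fun i hi => max_eq_right (sub_nonpos.2 (not_le.1
      (mt (hiff i γ).1 (mem_filter.1 hi).2)).le)
  have h3 : (univ.filter fun i : Fin (rk ⊤) => (i : ℕ) < rk (G γ)).card = rk (G γ) := by
    rw [Fin.card_filter_val_lt]
    exact min_eq_right (h.strictMono.monotone le_top)
  rw [h1, h2, sum_sub_distrib, sum_const, h3, nsmul_eq_mul]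
  ring

lemma antitone_filtrationType (h : IsSlopeDatum rk d) (hG : IsHNFiltration rk d G) :
    Antitone (filtrationType rk G (rk ⊤)) := by
  have hiff := le_filtrationType_iff h.strictMono.monotone h.rk_bot hG.1
  intro i j hij
  rw [hiff]
  exact lt_of_le_of_lt hij ((hiff j _).1 le_rfl)

open Finset in
lemma sum_filtrationType_eq (h : IsSlopeDatum rk d) (hG : IsHNFiltration rk d G) :
    ∑ i : Fin (rk ⊤), filtrationType rk G (rk ⊤) i = d ⊤ := by
  obtain ⟨a, ha⟩ := hG.1.exhaustive
  rw [← ha a le_rfl, ← hG.sum_filtrationType h a]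
  rw [ha a le_rfl]
  exact sum_congr (by simp) fun _ _ => rfl

end IsHNFiltration

open Finset in
/-- Majorisation of antitone sequences through the functions `x ↦ max (x - γ) 0`. -/
lemma typeLE_of_sum_max_le {r : ℕ} {t t' : Fin r → ℝ} (ht : Antitone t) (ht' : Antitone t')
    (hmax : ∀ γ, ∑ i, max (t i - γ) 0 ≤ ∑ i, max (t' i - γ) 0) (hsum : ∑ i, t i = ∑ i, t' i) :
    TypeLE t t' := by
  refine ⟨ht, ht', fun s => ?_, hsum⟩
  -- The choice `γ = t' s` is sharp for `t'`: its positive parts are supported on the indices up to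
  -- `s`.
  have h1 : ∑ i ∈ Iic s, (t i - t' s) ≤ ∑ i, max (t i - t' s) 0 :=
    (sum_le_sum fun i _ => le_max_left _ _).trans
      (sum_le_sum_of_subset_of_nonneg (subset_univ _) fun i _ _ => le_max_right _ _)
  have h2 : ∑ i, max (t' i - t' s) 0 = ∑ i ∈ Iic s, (t' i - t' s) := by
    rw [← sum_subset (subset_univ (Iic s))]
    · exact sum_congr rfl fun i hi => max_eq_left (sub_nonneg.2 (ht' (mem_Iic.1 hi)))
    · intro i _ hi
      exact max_eq_right (sub_nonpos.2 (ht' (not_le.1 (mt mem_Iic.2 hi)).le))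
  have h3 := h1.trans ((hmax (t' s)).trans_eq h2)
  rw [sum_sub_distrib, sum_sub_distrib] at h3
  linarith

/-! ## Matrices over valuation rings -/

section Smith

open Matrix

variable {R : Type*} [CommRing R]

/-- Equivalence of a matrix to a diagonal one. -/
def Matrix.IsEquivDiagonal {n : Type*} [Fintype n] [DecidableEq n] (A : Matrix n n R) : Prop :=
  ∃ P Q : Matrix n n R, IsUnit P.det ∧ IsUnit Q.det ∧ ∃ d, P * A * Q = diagonal d

namespace Matrix.IsEquivDiagonal

variable {n m : Type*} [Fintype n] [DecidableEq n] [Fintype m] [DecidableEq m]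

lemma of_mul {A P Q : Matrix n n R} (hP : IsUnit P.det) (hQ : IsUnit Q.det)
    (h : (P * A * Q).IsEquivDiagonal) : A.IsEquivDiagonal := by
  obtain ⟨P', Q', hP', hQ', d, hd⟩ := h
  refine ⟨P' * P, Q * Q', ?_, ?_, d, ?_⟩
  · rw [det_mul]; exact hP'.mul hP
  · rw [det_mul]; exact hQ.mul hQ'
  · rw [← hd]; simp only [Matrix.mul_assoc]

lemma of_submatrix {A : Matrix n n R} (e f : m ≃ n)
    (h : (A.submatrix e f).IsEquivDiagonal) : A.IsEquivDiagonal := by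
  obtain ⟨P, Q, hP, hQ, d, hd⟩ := h
  refine ⟨P.submatrix e.symm e.symm, Q.submatrix f.symm e.symm, ?_, ?_, d ∘ e.symm, ?_⟩
  · rwa [det_submatrix_equiv_self]
  · have : Q.submatrix f.symm e.symm =
        (Q.submatrix e.symm e.symm).submatrix (f.symm.trans e) id := by ext; simp
    rw [this, det_permute, det_submatrix_equiv_self]
    exact ((Equiv.Perm.sign (f.symm.trans e)).isUnit.map (Int.castRingHom R)).mul hQ
  · have : A = (A.submatrix e f).submatrix e.symm f.symm := by simp
    rw [this, submatrix_mul_equiv, submatrix_mul_equiv, hd, submatrix_diagonal_equiv]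

/-- One step of Gaussian elimination: a pivot dividing its row and column clears both by unipotent
matrices and leaves the Schur complement `C - a w u`. -/
lemma fromBlocks_of_dvd {k : ℕ} (hk : ∀ A : Matrix (Fin k) (Fin k) R, A.IsEquivDiagonal)
    (a : R) (u : Matrix Unit (Fin k) R) (w : Matrix (Fin k) Unit R) (C : Matrix (Fin k) (Fin k) R) :
    (fromBlocks (of fun _ _ => a) (a • u) (a • w) C).IsEquivDiagonal := by
  obtain ⟨P, Q, hP, hQ, d, hd⟩ := hk (C - a • (w * u))
  have h1 : (fromBlocks 1 0 (-w) 1 : Matrix (Unit ⊕ Fin k) (Unit ⊕ Fin k) R) *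
      fromBlocks (of fun _ _ => a) (a • u) (a • w) C *
      fromBlocks 1 (-u) 0 1 = fromBlocks (of fun _ _ => a) 0 0 (C - a • (w * u)) := by
    have h2 : (of fun _ _ => a : Matrix Unit Unit R) = a • 1 := by ext; simp
    rw [h2, fromBlocks_multiply, fromBlocks_multiply]
    simp [sub_eq_add_neg, add_comm]
  refine of_mul (P := fromBlocks 1 0 (-w) 1) (Q := fromBlocks 1 (-u) 0 1) (by simp) (by simp) ?_
  rw [h1]
  refine ⟨fromBlocks 1 0 0 P, fromBlocks 1 0 0 Q, by simpa using hP, by simpa using hQ,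
    Sum.elim (fun _ => a) d, ?_⟩
  rw [fromBlocks_multiply, fromBlocks_multiply, ← fromBlocks_diagonal]
  have h2 : (of fun _ _ => a : Matrix Unit Unit R) = diagonal fun _ => a := by ext; simp
  simp [hd, h2]

end Matrix.IsEquivDiagonal

/-- The elementary divisor theorem over valuation rings. -/
theorem Matrix.isEquivDiagonal_of_valuationRing [IsDomain R] [ValuationRing R] (k : ℕ) :
    ∀ A : Matrix (Fin k) (Fin k) R, A.IsEquivDiagonal := by
  induction k with
  | zero => exact fun A => ⟨1, 1, by simp, by simp, 0, Subsingleton.elim _ _⟩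
  | succ k ih =>
    intro A
    -- Divisibility is total in a valuation ring, so some entry divides all the others and can serve
    -- as pivot.
    obtain ⟨⟨i, j⟩, hij⟩ : ∃ ij : Fin (k + 1) × Fin (k + 1), ∀ kl : Fin (k + 1) × Fin (k + 1),
        A ij.1 ij.2 ∣ A kl.1 kl.2 := by
      have hfin : ∀ s : Finset (Fin (k + 1) × Fin (k + 1)), s.Nonempty →
          ∃ ij : Fin (k + 1) × Fin (k + 1), ∀ kl ∈ s, A ij.1 ij.2 ∣ A kl.1 kl.2 := by
        intro s hs
        induction hs using Finset.Nonempty.cons_induction with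
        | singleton a => exact ⟨a, by simp⟩
        | cons a s ha hs ih =>
          obtain ⟨b, hb⟩ := ih
          rcases ValuationRing.dvd_total (A a.1 a.2) (A b.1 b.2) with h | h
          · refine ⟨a, fun kl hkl => ?_⟩
            rcases Finset.mem_cons.1 hkl with rfl | hkl
            · exact dvd_rfl
            · exact h.trans (hb _ hkl)
          · refine ⟨b, fun kl hkl => ?_⟩
            rcases Finset.mem_cons.1 hkl with rfl | hkl
            · exact h
            · exact hb _ hkl
      obtain ⟨ij, h⟩ := hfin Finset.univ Finset.univ_nonempty
      exact ⟨ij, fun kl => h kl (Finset.mem_univ _)⟩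
    obtain ⟨e, he⟩ : ∃ e : Unit ⊕ Fin k ≃ Fin (k + 1), e (Sum.inl ()) = 0 :=
      ⟨(Equiv.sumComm _ _).trans ((Equiv.optionEquivSumPUnit _).symm.trans
        (finSuccEquiv k).symm), by simp⟩
    refine IsEquivDiagonal.of_submatrix (e.trans (Equiv.swap 0 i)) (e.trans (Equiv.swap 0 j)) ?_
    set B := A.submatrix (e.trans (Equiv.swap 0 i)) (e.trans (Equiv.swap 0 j)) with hB
    have hdvd : ∀ x y, A i j ∣ B x y := fun x y => hij (_, _)
    choose g hg using hdvd
    have : B = fromBlocks (of fun _ _ => A i j) (A i j • of fun x y => g (Sum.inl x) (Sum.inr y))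
        (A i j • of fun x y => g (Sum.inr x) (Sum.inl y)) B.toBlocks₂₂ := by
      ext (x | x) (y | y)
      · simp [hB, he]
      · simp [hg]
      · simp [hg]
      · simp [toBlocks₂₂]
    rw [this]
    exact IsEquivDiagonal.fromBlocks_of_dvd ih _ _ _ _

/-- The determinant of a square presentation matrix of a module divides that of any other one. -/
lemma Matrix.det_dvd_det_of_presentation {n m Q : Type*} [Fintype n] [DecidableEq n]
    [Fintype m] [DecidableEq m] [AddCommGroup Q] [Module R Q] (X : Matrix n n R) (Y : Matrix m m R)
    (f : (n → R) →ₗ[R] Q) (g : (m → R) →ₗ[R] Q) (hf : Function.Surjective f)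
    (hg : Function.Surjective g) (hX : LinearMap.range X.mulVecLin ≤ LinearMap.ker f)
    (hY : LinearMap.ker g ≤ LinearMap.range Y.mulVecLin) : Y.det ∣ X.det := by
  obtain ⟨α, hα⟩ := Module.projective_lifting_property f g hf
  obtain ⟨β, hβ⟩ := Module.projective_lifting_property g f hg
  -- Both presentations are compared with the joint one `(u, v) ↦ f u + g v`. The columns of `(1, 0;
  -- -β, Y)` generate its relations, and those of `(X, -α; 0, 1)` are relations. So the second
  -- matrix factors through the first, and the determinants are those of `Y` and `X`.
  have key : ∀ (u : n → R) (v : m → R), f u + g v = 0 → ∃ z : n ⊕ m → R,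
      (fromBlocks 1 0 (-β.toMatrix') Y) *ᵥ z = Sum.elim u v := by
    intro u v huv
    have h1 : v + β u ∈ LinearMap.ker g := by
      rw [LinearMap.mem_ker, map_add, ← LinearMap.comp_apply g β, hβ, add_comm, huv]
    obtain ⟨w, hw⟩ := hY h1
    refine ⟨Sum.elim u w, ?_⟩
    rw [mulVecLin_apply] at hw
    rw [fromBlocks_mulVec]
    simp [neg_mulVec, hw]
  have hcol : ∀ j, ∃ z : n ⊕ m → R, (fromBlocks 1 0 (-β.toMatrix') Y) *ᵥ z =
      fun i => (fromBlocks X (-α.toMatrix') 0 1) i j := by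
    rintro (j | j)
    · obtain ⟨z, hz⟩ := key (X *ᵥ Pi.single j 1) 0 (by
        rw [map_zero, add_zero]
        exact hX ⟨_, rfl⟩)
      refine ⟨z, hz.trans ?_⟩
      ext (i | i) <;> simp
    · obtain ⟨z, hz⟩ := key (-α (Pi.single j 1)) (Pi.single j 1) (by
        rw [map_neg, ← LinearMap.comp_apply f α, hα, neg_add_cancel])
      refine ⟨z, hz.trans ?_⟩
      ext (i | i)
      · simp [LinearMap.toMatrix'_apply]
      · simp [one_apply, Pi.single_apply]
  choose U hU using hcol
  have : fromBlocks X (-α.toMatrix') 0 1 =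
      fromBlocks 1 0 (-β.toMatrix') Y * (of fun i j => U j i) := by
    ext i j
    exact (congrFun (hU j) i).symm
  have hdet := congrArg det this
  rw [det_mul, det_fromBlocks_zero₂₁, det_fromBlocks_zero₁₂, det_one, det_one, mul_one,
    one_mul] at hdet
  exact ⟨_, hdet⟩

/-- A product of cyclic modules has a diagonal presentation matrix. -/
lemma exists_ker_eq_range_diagonal {n : Type*} [Fintype n] [DecidableEq n]
    {Q : Type*} [AddCommGroup Q] [Module R Q] {x : n → R}
    (e : Q ≃ₗ[R] ((i : n) → R ⧸ Ideal.span {x i})) : ∃ f : (n → R) →ₗ[R] Q,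
    Function.Surjective f ∧ LinearMap.ker f = LinearMap.range (diagonal x).mulVecLin := by
  refine ⟨e.symm.toLinearMap ∘ₗ LinearMap.pi fun i =>
    (Ideal.span {x i}).mkQ ∘ₗ LinearMap.proj i, ?_, ?_⟩
  · refine e.symm.surjective.comp fun z => ?_
    choose w hw using fun i => Submodule.mkQ_surjective _ (z i)
    exact ⟨w, funext hw⟩
  · ext z
    simp only [LinearEquiv.ker_comp, LinearMap.mem_ker, LinearMap.mem_range]
    constructor
    · intro h
      have h1 : ∀ i, ∃ w, w * x i = z i := fun i => by
        have := congrFun h i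
        rw [LinearMap.pi_apply, LinearMap.comp_apply, LinearMap.proj_apply,
          Submodule.mkQ_apply, Pi.zero_apply, Submodule.Quotient.mk_eq_zero,
          Ideal.mem_span_singleton'] at this
        exact this
      choose w hw using h1
      exact ⟨w, funext fun i => by simp [mulVec_diagonal, ← hw, mul_comm]⟩
    · rintro ⟨w, rfl⟩
      ext i
      rw [LinearMap.pi_apply, LinearMap.comp_apply, LinearMap.proj_apply,
          Submodule.mkQ_apply, Pi.zero_apply, Submodule.Quotient.mk_eq_zero,
          Ideal.mem_span_singleton']
      exact ⟨w i, by simp [mulVec_diagonal, mul_comm]⟩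

/-- The product of the elementary divisors of a module is well-defined up to a unit. -/
lemma associated_prod_of_linearEquiv {n m : Type*} [Fintype n] [Fintype m]
    {Q : Type*} [AddCommGroup Q] [Module R Q] {x : n → R} {y : m → R} [IsDomain R]
    (e : Q ≃ₗ[R] ((i : n) → R ⧸ Ideal.span {x i}))
    (e' : Q ≃ₗ[R] ((i : m) → R ⧸ Ideal.span {y i})) :
    Associated (∏ i, x i) (∏ i, y i) := by
  classical
  obtain ⟨f, hf, hf'⟩ := exists_ker_eq_range_diagonal e
  obtain ⟨g, hg, hg'⟩ := exists_ker_eq_range_diagonal e'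
  rw [← det_diagonal, ← det_diagonal]
  exact associated_of_dvd_dvd
    (det_dvd_det_of_presentation _ _ g f hg hf hg'.ge hf'.le)
    (det_dvd_det_of_presentation _ _ f g hf hg hf'.ge hg'.le)

end Smith

/-! ## Absolute values attached to valuation rings -/

/-- A non-archimedean absolute value on `F` with ring of integers `R`. -/
structure IsNormOfRing (R : Type*) {F : Type*} [CommRing R] [Field F] [Algebra R F]
    (nrm : F → ℝ) : Prop where
  map_mul : ∀ x y, nrm (x * y) = nrm x * nrm y
  map_zero : nrm 0 = 0
  pos : ∀ x, x ≠ 0 → 0 < nrm x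
  le_one_iff : ∀ x, nrm x ≤ 1 ↔ ∃ a, algebraMap R F a = x

namespace IsNormOfRing

variable {R F : Type*} [CommRing R] [Field F] [Algebra R F] {nrm : F → ℝ}

lemma nonneg (h : IsNormOfRing R nrm) (x : F) : 0 ≤ nrm x := by
  by_cases hx : x = 0
  · rw [hx, h.map_zero]
  · exact (h.pos x hx).le

lemma map_one (h : IsNormOfRing R nrm) : nrm 1 = 1 := by
  have h1 := h.map_mul 1 1
  rw [mul_one] at h1
  have h2 := h.pos 1 one_ne_zero
  nlinarith

/-- The absolute value as a monoid homomorphism. -/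
def toMonoidHom (h : IsNormOfRing R nrm) : F →* ℝ where
  toFun := nrm
  map_one' := h.map_one
  map_mul' := h.map_mul

lemma map_pow (h : IsNormOfRing R nrm) (x : F) (n : ℕ) : nrm (x ^ n) = nrm x ^ n :=
  h.toMonoidHom.map_pow x n

lemma map_prod (h : IsNormOfRing R nrm) {ι : Type*} (s : Finset ι) (x : ι → F) :
    nrm (∏ i ∈ s, x i) = ∏ i ∈ s, nrm (x i) :=
  _root_.map_prod h.toMonoidHom x s

lemma map_algebraMap_le_one (h : IsNormOfRing R nrm) (a : R) : nrm (algebraMap R F a) ≤ 1 :=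
  (h.le_one_iff _).2 ⟨a, rfl⟩

lemma map_isUnit (h : IsNormOfRing R nrm) {a : R} (ha : IsUnit a) :
    nrm (algebraMap R F a) = 1 := by
  obtain ⟨u, rfl⟩ := ha
  have h1 := h.map_algebraMap_le_one (u : R)
  have h2 := h.map_algebraMap_le_one ((u⁻¹ : Rˣ) : R)
  have h3 : nrm (algebraMap R F u) * nrm (algebraMap R F (u⁻¹ : Rˣ)) = 1 := by
    rw [← h.map_mul, ← _root_.map_mul, Units.mul_inv, _root_.map_one, h.map_one]
  nlinarith [h.nonneg (algebraMap R F u), h.nonneg (algebraMap R F (u⁻¹ : Rˣ))]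

lemma map_associated (h : IsNormOfRing R nrm) {a b : R} (hab : Associated a b) :
    nrm (algebraMap R F a) = nrm (algebraMap R F b) := by
  obtain ⟨u, rfl⟩ := hab
  rw [_root_.map_mul, h.map_mul, h.map_isUnit u.isUnit, mul_one]

lemma le_iff (h : IsNormOfRing R nrm) {x y : F} (hy : y ≠ 0) :
    nrm x ≤ nrm y ↔ ∃ a : R, x = a • y := by
  have h1 : nrm x = nrm (x / y) * nrm y := by rw [← h.map_mul, div_mul_cancel₀ _ hy]
  have h2 : nrm x ≤ nrm y ↔ nrm (x / y) ≤ 1 := by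
    rw [h1]
    exact mul_le_iff_le_one_left (h.pos y hy)
  rw [h2, h.le_one_iff]
  refine exists_congr fun a => ?_
  rw [eq_div_iff hy, Algebra.smul_def, eq_comm]

/-- A sum is bounded by its largest term. -/
lemma exists_sum_le (h : IsNormOfRing R nrm) {ι : Type*} {s : Finset ι} (x : ι → F)
    (hs : ∑ i ∈ s, x i ≠ 0) : ∃ i ∈ s, x i ≠ 0 ∧ nrm (∑ i ∈ s, x i) ≤ nrm (x i) := by
  have hne : s.Nonempty := by
    rw [Finset.nonempty_iff_ne_empty]
    rintro rfl
    simp at hs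
  obtain ⟨i, hi, hmax⟩ := s.exists_max_image (fun i => nrm (x i)) hne
  have hxi : x i ≠ 0 := fun h0 => hs <| Finset.sum_eq_zero fun j hj => by
    by_contra hj0
    have := hmax j hj
    rw [h0, h.map_zero] at this
    exact absurd (h.pos _ hj0) (not_lt.2 this)
  -- All terms are integral multiples of the largest one, hence so is the sum: the ultrametric
  -- inequality comes from closure of the ring under addition.
  refine ⟨i, hi, hxi, (h.le_iff hxi).2 ?_⟩
  choose! a ha using fun j hj => (h.le_iff hxi).1 (hmax j hj)
  exact ⟨∑ j ∈ s, a j, by rw [Finset.sum_smul]; exact Finset.sum_congr rfl ha⟩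

open Matrix in
/-- The determinant of `P D C`, with `P` and `C` integral and `D` diagonal, is bounded by the
product of some of the entries of `D`. -/
lemma exists_det_le (h : IsNormOfRing R nrm) {m n : Type*} [Fintype m] [DecidableEq m] [Fintype n]
    [DecidableEq n] (P : Matrix m n R) (C : Matrix n m R) (l : n → F)
    (hdet : (P.map (algebraMap R F) * diagonal l * C.map (algebraMap R F)).det ≠ 0) :
    ∃ f : m → n, Function.Injective f ∧
      nrm (P.map (algebraMap R F) * diagonal l * C.map (algebraMap R F)).det ≤
        ∏ j, nrm (l (f j)) := by
  set p : n → m → F := fun k i => algebraMap R F (P i k) with hp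
  -- Multilinear expansion in the columns, as for Cauchy-Binet. Non-injective choices vanish by
  -- alternation; in the other terms the minor of `P` and the entries of `C` are integral.
  have hexp : (P.map (algebraMap R F) * diagonal l * C.map (algebraMap R F)).det =
      ∑ f : m → n, (∏ j, l (f j) * algebraMap R F (C (f j) j)) •
        detRowAlternating (R := F) fun j => p (f j) := by
    have h1 : (P.map (algebraMap R F) * diagonal l * C.map (algebraMap R F))ᵀ =
        fun j => ∑ k, (l k * algebraMap R F (C k j)) • p k := by
      ext j i
      rw [transpose_apply, mul_apply, Finset.sum_apply]
      refine Finset.sum_congr rfl fun k _ => ?_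
      simp [mul_diagonal, hp]
      ring
    rw [← det_transpose, h1]
    change (detRowAlternating (R := F) (n := m)).toMultilinearMap _ = _
    rw [MultilinearMap.map_sum]
    refine Finset.sum_congr rfl fun f _ => ?_
    rw [MultilinearMap.map_smul_univ]
    rfl
  rw [hexp] at hdet ⊢
  obtain ⟨f, -, hf0, hf⟩ := h.exists_sum_le _ hdet
  have hinj : Function.Injective f := by
    by_contra hni
    refine hf0 ?_
    rw [AlternatingMap.map_eq_zero_of_not_injective _ _ fun hi => hni fun a b hab =>
      hi (by simp [hab]), smul_zero]
  refine ⟨f, hinj, hf.trans ?_⟩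
  have h2 : detRowAlternating (R := F) (fun j => p (f j)) =
      algebraMap R F (of fun j i => P i (f j)).det := by
    rw [RingHom.map_det]
    rfl
  rw [smul_eq_mul, h.map_mul, Finset.prod_mul_distrib, h.map_mul, h.map_prod, h.map_prod, h2,
    mul_assoc]
  refine mul_le_of_le_one_right (Finset.prod_nonneg fun _ _ => h.nonneg _) ?_
  refine mul_le_one₀ (Finset.prod_le_one (fun _ _ => h.nonneg _)
    fun _ _ => h.map_algebraMap_le_one _) (h.nonneg _) (h.map_algebraMap_le_one _)

variable {q : ℕ}

/-- The choice in `normLength` is harmless: the product of the generators is determined up to a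
unit, which has norm one. -/
lemma normLength_eq [IsDomain R] [IsFractionRing R F] (h : IsNormOfRing R nrm) {Q : Type*}
    [AddCommGroup Q] [Module R Q]
    {ℓ : ℝ} (hQ : IsLength (R := R) q nrm Q ℓ) : normLength (R := R) q nrm Q = ℓ := by
  have hex : ∃ ℓ, IsLength (R := R) q nrm Q ℓ := ⟨ℓ, hQ⟩
  rw [normLength, dif_pos hex]
  obtain ⟨n, x, hx, ⟨e⟩, h1⟩ := hex.choose_spec
  obtain ⟨m, y, hy, ⟨e'⟩, h2⟩ := hQ
  have key : ∀ {n : ℕ} (x : Fin n → R), (∀ i, x i ≠ 0) →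
      ∑ i, Real.logb q (nrm (algebraMap R F (x i))) =
        Real.logb q (nrm (algebraMap R F (∏ i, x i))) := fun x hx => by
    rw [_root_.map_prod, h.map_prod, Real.logb_prod]
    intro i _
    exact (h.pos _ (by simpa using hx i)).ne'
  rw [h1, h2, key x hx, key y hy, h.map_associated (associated_prod_of_linearEquiv e e')]

end IsNormOfRing


/-! ## Bases of lattices -/

/-- A family of vectors which is a basis of the lattice `N` of an `F`-vector space. -/
structure IsLatticeBasis {R : Type*} (F : Type*) {V ι : Type*} [CommRing R] [Field F]
    [AddCommGroup V] [Module F V] [Module R V] (b : ι → V) (N : Submodule R V) : Prop where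
  linearIndependent : LinearIndependent F b
  span_eq : Submodule.span R (Set.range b) = N

section LatticeBasis

variable {R F V ι : Type*} [CommRing R] [Field F] [Algebra R F] [AddCommGroup V] [Module F V]
  [Module R V] [IsScalarTower R F V]

/-- Coordinates with respect to a linearly independent family are unique. -/
lemma LinearIndependent.matrix_ext {κ : Type*} [Fintype ι] {b : ι → V}
    (hb : LinearIndependent F b) {A B : Matrix ι κ F}
    (h : ∀ j, ∑ i, A i j • b i = ∑ i, B i j • b i) : A = B := by
  ext i j
  have h1 : ∑ i, (A i j - B i j) • b i = 0 := by
    simp_rw [sub_smul, Finset.sum_sub_distrib, h j, sub_self]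
  exact sub_eq_zero.1 (Fintype.linearIndependent_iff.1 hb _ h1 i)

lemma sum_smul_sum_smul {κ l : Type*} [Fintype ι] [Fintype κ] (b : ι → V) (A : Matrix ι κ F)
    (B : Matrix κ l F) (j : l) :
    ∑ k, B k j • ∑ i, A i k • b i = ∑ i, (A * B) i j • b i := by
  simp_rw [Finset.smul_sum, smul_smul, Matrix.mul_apply, Finset.sum_smul]
  rw [Finset.sum_comm]
  simp_rw [mul_comm]

namespace IsLatticeBasis

variable {b : ι → V} {N : Submodule R V}

lemma mem (h : IsLatticeBasis F b N) (i : ι) : b i ∈ N :=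
  h.span_eq ▸ Submodule.subset_span ⟨i, rfl⟩

lemma span_field (h : IsLatticeBasis F b N) :
    Submodule.span F (N : Set V) = Submodule.span F (Set.range b) := by
  rw [← h.span_eq]
  exact Submodule.span_span_of_tower R F _

lemma mem_iff [Fintype ι] (h : IsLatticeBasis F b N) (x : V) :
    x ∈ N ↔ ∃ c : ι → R, ∑ i, algebraMap R F (c i) • b i = x := by
  rw [← h.span_eq, Submodule.mem_span_range_iff_exists_fun]
  simp_rw [algebraMap_smul]

lemma exists_matrix [Fintype ι] (h : IsLatticeBasis F b N) {κ : Type*} {c : κ → V}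
    (hc : ∀ j, c j ∈ N) :
    ∃ P : Matrix ι κ R, ∀ j, c j = ∑ i, (P.map (algebraMap R F)) i j • b i := by
  choose P hP using fun j => (h.mem_iff _).1 (hc j)
  exact ⟨Matrix.of fun i j => P j i, fun j => (hP j).symm⟩

lemma exists_matrix_field [Fintype ι] (h : IsLatticeBasis F b N) {κ : Type*} {c : κ → V}
    (hc : ∀ j, c j ∈ Submodule.span F (N : Set V)) :
    ∃ P : Matrix ι κ F, ∀ j, c j = ∑ i, P i j • b i := by
  simp_rw [h.span_field, Submodule.mem_span_range_iff_exists_fun] at hc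
  choose P hP using hc
  exact ⟨Matrix.of fun i j => P j i, fun j => (hP j).symm⟩

variable [IsDomain R] [IsFractionRing R F]

lemma linearIndependent_ring (h : IsLatticeBasis F b N) : LinearIndependent R b :=
  (LinearIndependent.iff_fractionRing R F).2 h.linearIndependent

/-- The basis of the `R`-module `N`. -/
noncomputable def basis (h : IsLatticeBasis F b N) : Module.Basis ι R N :=
  (Module.Basis.span h.linearIndependent_ring).map (LinearEquiv.ofEq _ _ h.span_eq)

@[simp] lemma coe_basis (h : IsLatticeBasis F b N) (i : ι) : (h.basis i : V) = b i := by
  simp [basis, Module.Basis.span_apply]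

lemma finrank_eq [Fintype ι] (h : IsLatticeBasis F b N) :
    Module.finrank R N = Fintype.card ι :=
  Module.finrank_eq_card_basis h.basis

lemma finrank_field_eq [Fintype ι] (h : IsLatticeBasis F b N) :
    Module.finrank F (Submodule.span F (N : Set V)) = Fintype.card ι := by
  rw [h.span_field]
  exact finrank_span_eq_card h.linearIndependent

lemma of_basis (B : Module.Basis ι R N) : IsLatticeBasis F (fun i => (B i : V)) N where
  linearIndependent := (LinearIndependent.iff_fractionRing R F).1
    (B.linearIndependent.map' N.subtype N.ker_subtype)
  span_eq := by
    have : (Set.range fun i => (B i : V)) = N.subtype '' Set.range B := by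
      rw [← Set.range_comp]; rfl
    rw [this, Submodule.span_image, B.span_eq, Submodule.map_top, Submodule.range_subtype]

lemma reindex {κ : Type*} (e : κ ≃ ι) (h : IsLatticeBasis F b N) :
    IsLatticeBasis F (b ∘ e) N where
  linearIndependent := h.linearIndependent.comp _ e.injective
  span_eq := by rw [Set.range_comp, e.surjective.range_eq, Set.image_univ, h.span_eq]

end IsLatticeBasis

variable [IsDomain R] [IsFractionRing R F]

lemma Module.isTorsionFree_of_isFractionRing (F : Type*) [Field F] [Algebra R F]
    [IsFractionRing R F] [Module F V] [IsScalarTower R F V] (N : Submodule R V) :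
    Module.IsTorsionFree R N := by
  refine ⟨fun r hr x y hxy => Subtype.ext ?_⟩
  have h1 : algebraMap R F r ≠ 0 := by simpa using hr.ne_zero
  have h2 : r • (x : V) = r • (y : V) := congrArg Subtype.val hxy
  rw [← algebraMap_smul F r (x : V), ← algebraMap_smul F r (y : V)] at h2
  exact smul_right_injective V h1 h2

variable [ValuationRing R]

/-- Torsion-free modules over a Bézout domain are flat, and finite flat modules over a local ring
are free. -/
lemma Module.free_of_isTorsionFree_of_valuationRing {R : Type*} [CommRing R] [IsDomain R]
    [ValuationRing R] (Q : Type*) [AddCommGroup Q]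
    [Module R Q] [Module.Finite R Q] [Module.IsTorsionFree R Q] : Module.Free R Q := by
  have : Module.Flat R Q := Module.Flat.flat_iff_torsion_eq_bot_of_isBezout.2
    (Submodule.isTorsionFree_iff_torsion_eq_bot.1 inferInstance)
  exact Module.free_of_flat_of_isLocalRing

lemma exists_isLatticeBasis {N : Submodule R V} (hN : N.FG) :
    ∃ b : Fin (Module.finrank R N) → V, IsLatticeBasis F b N := by
  have := Module.isTorsionFree_of_isFractionRing F N
  have : Module.Finite R N := Module.Finite.iff_fg.2 hN
  have := Module.free_of_isTorsionFree_of_valuationRing (R := R) N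
  exact ⟨_, IsLatticeBasis.of_basis (Module.finBasis R N)⟩

/-- A basis of a saturated sublattice extends to a basis of the lattice. -/
lemma exists_isLatticeBasis_sum {N N' : Submodule R V} (hN : N.FG) (hle : N' ≤ N)
    (hsat : ∀ (a : R) (x : V), a ≠ 0 → x ∈ N → a • x ∈ N' → x ∈ N') :
    N'.FG ∧ ∃ (m n : ℕ) (b : Fin m ⊕ Fin n → V), IsLatticeBasis F b N ∧
      IsLatticeBasis F (b ∘ Sum.inl) N' := by
  have : Module.Finite R N := Module.Finite.iff_fg.2 hN
  have htf : Module.IsTorsionFree R (N ⧸ N'.submoduleOf N) := by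
    rw [Submodule.isTorsionFree_iff_torsion_eq_bot, eq_bot_iff]
    rintro x ⟨⟨a, ha⟩, hx⟩
    obtain ⟨x, rfl⟩ := Submodule.mkQ_surjective _ x
    rw [Submodule.mem_bot, Submodule.mkQ_apply, Submodule.Quotient.mk_eq_zero]
    replace hx : (N'.submoduleOf N).mkQ (a • x) = 0 := hx
    rw [Submodule.mkQ_apply, Submodule.Quotient.mk_eq_zero] at hx
    exact hsat a x (nonZeroDivisors.ne_zero ha) x.2 hx
  have := Module.free_of_isTorsionFree_of_valuationRing (R := R) (N ⧸ N'.submoduleOf N)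
  -- The free quotient splits off. The ring need not be noetherian, so finite generation of `N'`
  -- comes from the complementary projector `id - s ∘ mkQ`.
  obtain ⟨s, hs⟩ := Module.projective_lifting_property (N'.submoduleOf N).mkQ LinearMap.id
    (Submodule.mkQ_surjective _)
  have hs' : ∀ x, (N'.submoduleOf N).mkQ (s x) = x := fun x => LinearMap.congr_fun hs x
  have hmk : ∀ z : N, (N'.submoduleOf N).mkQ z = 0 ↔ (z : V) ∈ N' := fun z =>
    Submodule.Quotient.mk_eq_zero _
  have hfg : N'.FG := by
    have h1 : N' = (LinearMap.range
        (LinearMap.id - s ∘ₗ (N'.submoduleOf N).mkQ)).map N.subtype := by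
      ext x
      constructor
      · intro hx
        refine ⟨⟨x, hle hx⟩, ⟨⟨x, hle hx⟩, ?_⟩, rfl⟩
        have : (N'.submoduleOf N).mkQ ⟨x, hle hx⟩ = 0 := (hmk _).2 hx
        simp only [LinearMap.sub_apply, LinearMap.id_apply, LinearMap.comp_apply, this, map_zero,
          sub_zero]
      · rintro ⟨_, ⟨y, rfl⟩, rfl⟩
        refine (hmk (((LinearMap.id : N →ₗ[R] N) - s ∘ₗ (N'.submoduleOf N).mkQ) y)).1 ?_
        simp only [LinearMap.sub_apply, LinearMap.id_apply, LinearMap.comp_apply, map_sub, hs',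
          sub_self]
    rw [h1]
    exact (Module.Finite.iff_fg.1 inferInstance).map _
  refine ⟨hfg, ?_⟩
  obtain ⟨b', hb'⟩ := exists_isLatticeBasis (F := F) hfg
  set B := Module.finBasis R (N ⧸ N'.submoduleOf N)
  refine ⟨_, _, Sum.elim b' fun j => (s (B j) : V), ⟨?_, ?_⟩, by simpa using hb'⟩
  · rw [← LinearIndependent.iff_fractionRing R F, Fintype.linearIndependent_iff]
    intro g hg
    rw [Fintype.sum_sum_type] at hg
    simp only [Sum.elim_inl, Sum.elim_inr] at hg
    have h2 : ∑ j, g (Sum.inr j) • B j = 0 := by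
      have h3 : (N'.submoduleOf N).mkQ (s (∑ j, g (Sum.inr j) • B j)) = 0 := by
        rw [hmk]
        have h4 : ((s (∑ j, g (Sum.inr j) • B j) : N) : V) =
            ∑ j, g (Sum.inr j) • (s (B j) : V) := by
          simp only [map_sum, map_smul, Submodule.coe_sum, Submodule.coe_smul]
        rw [h4, ← neg_eq_of_add_eq_zero_right hg]
        exact neg_mem (sum_mem fun i _ => N'.smul_mem _ (hb'.mem i))
      rwa [hs'] at h3
    have h3 : ∀ j, g (Sum.inr j) = 0 := Fintype.linearIndependent_iff.1 B.linearIndependent _ h2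
    simp only [h3, zero_smul, Finset.sum_const_zero, add_zero] at hg
    have h4 := Fintype.linearIndependent_iff.1 hb'.linearIndependent_ring _ hg
    rintro (i | j)
    · exact h4 i
    · exact h3 j
  · refine le_antisymm (Submodule.span_le.2 ?_) fun x hx => ?_
    · rintro _ ⟨i | j, rfl⟩
      · exact hle (hb'.mem i)
      · exact (s (B j)).2
    · obtain ⟨y, hy⟩ : ∃ y, y = (N'.submoduleOf N).mkQ ⟨x, hx⟩ := ⟨_, rfl⟩
      have h1 : x - (s y : V) ∈ Submodule.span R (Set.range b') := by
        rw [hb'.span_eq]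
        exact (hmk (⟨x, hx⟩ - s y)).1 (by rw [map_sub, hs', ← hy, sub_self])
      have h2 : (s y : V) ∈ Submodule.span R (Set.range (Sum.elim b' fun j => (s (B j) : V))) := by
        rw [← B.sum_repr y]
        simp only [map_sum, map_smul, Submodule.coe_sum, Submodule.coe_smul]
        exact sum_mem fun j _ => Submodule.smul_mem _ _ (Submodule.subset_span ⟨Sum.inr j, rfl⟩)
      rw [← sub_add_cancel x (s y : V)]
      refine add_mem ?_ h2
      refine Submodule.span_mono ?_ h1
      rintro _ ⟨i, rfl⟩
      exact ⟨Sum.inl i, rfl⟩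

open Matrix in
/-- Adapted bases of two lattices in the same vector space. -/
lemma IsLatticeBasis.exists_adapted {k : ℕ} {N N' : Submodule R V} {b b' : Fin k → V}
    (hb : IsLatticeBasis F b N) (hb' : IsLatticeBasis F b' N')
    (hspan : ∀ j, b' j ∈ Submodule.span F (N : Set V)) :
    ∃ (e : Fin k → V) (l : Fin k → F), IsLatticeBasis F e N ∧ (∀ i, l i ≠ 0) ∧
      IsLatticeBasis F (fun i => l i • e i) N' := by
  obtain ⟨A, hA⟩ := hb.exists_matrix_field hspan
  -- A common denominator `a` makes the change-of-basis matrix integral; its elementary divisors `d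
  -- i` then yield the scalars `d i / a`.
  obtain ⟨a, ha⟩ := IsLocalization.exist_integer_multiples (nonZeroDivisors R) Finset.univ
    fun ij : Fin k × Fin k => A ij.1 ij.2
  have ha0 : algebraMap R F a ≠ 0 := by
    simp
  choose A' hA' using fun i j => ha (i, j) (Finset.mem_univ _)
  have hA'' : (of A').map (algebraMap R F) = algebraMap R F a • A := by
    ext i j
    rw [map_apply, of_apply, hA', Matrix.smul_apply, Algebra.smul_def, smul_eq_mul]
  obtain ⟨P, Q, hP, hQ, d, hd⟩ := isEquivDiagonal_of_valuationRing k (of A')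
  have hd' : A * Q.map (algebraMap R F) = P⁻¹.map (algebraMap R F) *
      diagonal fun i => (algebraMap R F a)⁻¹ * algebraMap R F (d i) := by
    have h1 : of A' * Q = P⁻¹ * diagonal d := by
      rw [← hd, ← Matrix.mul_assoc, ← Matrix.mul_assoc, nonsing_inv_mul _ hP, Matrix.one_mul]
    have h2 := congrArg (fun M => M.map (algebraMap R F)) h1
    simp only [Matrix.map_mul, hA'', diagonal_map (map_zero (algebraMap R F))] at h2
    have h3 : (diagonal fun i => (algebraMap R F a)⁻¹ * algebraMap R F (d i)) =
        (algebraMap R F a)⁻¹ • diagonal fun i => algebraMap R F (d i) := by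
      ext i j
      simp [diagonal_apply]
    rw [h3, Matrix.mul_smul]
    rw [← h2, Matrix.smul_mul, inv_smul_smul₀ ha0]
  have htrans : ∀ {N : Submodule R V} {b : Fin k → V} (_ : IsLatticeBasis F b N)
      (U : Matrix (Fin k) (Fin k) R) (_ : IsUnit U.det),
      IsLatticeBasis F (fun j => ∑ i, U.map (algebraMap R F) i j • b i) N := by
    intro N b hb U hU
    have hback : ∀ j, b j = ∑ k, U⁻¹.map (algebraMap R F) k j •
        ∑ i, U.map (algebraMap R F) i k • b i := by
      intro j
      rw [sum_smul_sum_smul, ← Matrix.map_mul, mul_nonsing_inv _ hU,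
        Matrix.map_one _ (map_zero _) (map_one _)]
      simp [one_apply, ite_smul]
    have hspan : Submodule.span R (Set.range fun j =>
        ∑ i, U.map (algebraMap R F) i j • b i) = N := by
      refine le_antisymm (Submodule.span_le.2 ?_) ?_
      · rintro _ ⟨j, rfl⟩
        exact (hb.mem_iff _).2 ⟨fun i => U i j, rfl⟩
      · rw [← hb.span_eq, Submodule.span_le]
        rintro _ ⟨j, rfl⟩
        rw [hback j]
        refine sum_mem fun i _ => ?_
        rw [map_apply, algebraMap_smul]
        exact Submodule.smul_mem _ _ (Submodule.subset_span ⟨i, rfl⟩)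
    refine ⟨?_, hspan⟩
    -- A generating family with as many members as the dimension is independent.
    rw [linearIndependent_iff_card_eq_finrank_span, Set.finrank, ← Submodule.span_span_of_tower R,
      hspan, hb.finrank_field_eq]
  have hQ' := htrans hb' Q hQ
  have hP' := htrans hb P⁻¹ ((isUnit_nonsing_inv_det_iff (A := P)).2 hP)
  have heq : (fun j => ∑ i, Q.map (algebraMap R F) i j • b' i) =
      fun j => ((algebraMap R F a)⁻¹ * algebraMap R F (d j)) •
        ∑ i, P⁻¹.map (algebraMap R F) i j • b i := by
    funext j
    simp_rw [hA]
    rw [sum_smul_sum_smul, hd', Finset.smul_sum]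
    refine Finset.sum_congr rfl fun i _ => ?_
    rw [mul_diagonal, smul_smul, mul_comm]
  rw [heq] at hQ'
  refine ⟨_, _, hP', fun i h0 => ?_, hQ'⟩
  have := hQ'.linearIndependent.ne_zero i
  simp only [h0, zero_smul, ne_eq, not_true_eq_false] at this

end LatticeBasis


/-! ## The degree of a `φ`-module -/

/-- An absolute value on `F` with ring of integers `R` which is compatible with the Frobenius `σ`,
and an element `ϖ` with `q |ϖ^q| = 1`. -/
structure IsFrobeniusNorm (R : Type*) {F : Type*} [CommRing R] [Field F] [Algebra R F]
    (σ : F →+* F) (q : ℕ) (nrm : F → ℝ) (ϖ : F) : Prop extends IsNormOfRing R nrm where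
  one_lt : 1 < q
  map_frob : ∀ x, nrm (σ x) = nrm x ^ q
  map_unif : q * nrm (ϖ ^ q) = 1

lemma IsFrobeniusNorm.norm_unif {R F : Type*} [CommRing R] [Field F] [Algebra R F]
    {σ : F →+* F} {q : ℕ} {nrm : F → ℝ} {ϖ : F} (h : IsFrobeniusNorm R σ q nrm ϖ) :
    nrm (ϖ ^ q) = (q : ℝ)⁻¹ :=
  eq_inv_of_mul_eq_one_right h.map_unif

namespace PhiModule

universe uR uF uV

variable {R : Type uR} {F : Type uF} [CommRing R] [IsDomain R] [Field F] [Algebra R F]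
  [IsFractionRing R F] {σ : F →+* F} {q : ℕ} {nrm : F → ℝ} {ϖ : F}

/-- `A` is the matrix of `φ` in the basis `b` of `X`. -/
structure IsFrobMatrix (X : PhiModule.{uR, uF, uV} R F σ) {ι : Type*} [Fintype ι] (b : ι → X.V)
    (A : Matrix ι ι F) : Prop where
  isBasis : IsLatticeBasis F b X.L
  map_eq : ∀ j, X.φ (b j) = ∑ i, A i j • b i

variable {X : PhiModule.{uR, uF, uV} R F σ}

lemma IsFrobMatrix.reindex {ι κ : Type*} [Fintype ι] [Fintype κ] {b : ι → X.V}
    {A : Matrix ι ι F} (hA : X.IsFrobMatrix b A) (s : κ ≃ ι) :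
    X.IsFrobMatrix (b ∘ s) (A.submatrix s s) :=
  ⟨hA.isBasis.reindex s, fun j => by
    rw [Function.comp_apply, hA.map_eq, ← s.sum_comp]
    rfl⟩

lemma exists_smul_mem_L (x : X.V) : ∃ a : R, a ≠ 0 ∧ a • x ∈ X.L := by
  have hx : x ∈ Submodule.span F (X.L : Set X.V) := X.span_L ▸ Submodule.mem_top
  induction hx using Submodule.span_induction with
  | mem x hx => exact ⟨1, one_ne_zero, by rwa [one_smul]⟩
  | zero => exact ⟨1, one_ne_zero, by rw [smul_zero]; exact zero_mem _⟩
  | add x y _ _ hx hy =>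
    obtain ⟨a, ha, hx⟩ := hx
    obtain ⟨b, hb, hy⟩ := hy
    refine ⟨a * b, mul_ne_zero ha hb, ?_⟩
    rw [smul_add]
    refine add_mem ?_ ?_
    · rw [mul_comm, mul_smul]
      exact X.L.smul_mem _ hx
    · rw [mul_smul]
      exact X.L.smul_mem _ hy
  | smul c x _ hx =>
    obtain ⟨a, ha, hx⟩ := hx
    obtain ⟨r, s, hs, rfl⟩ := IsFractionRing.div_surjective (A := R) c
    have hs0 : s ≠ 0 := nonZeroDivisors.ne_zero hs
    refine ⟨s * a, mul_ne_zero hs0 ha, ?_⟩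
    have h1 : (s * a) • (algebraMap R F r / algebraMap R F s) • x = r • a • x := by
      simp only [← algebraMap_smul F (_ : R) (_ : X.V), smul_smul, map_mul]
      have : algebraMap R F s ≠ 0 := by simpa using hs0
      congr 1
      field_simp
    rw [h1]
    exact X.L.smul_mem _ hx

lemma span_range_field {ι : Type*} {b : ι → X.V} (h : IsLatticeBasis F b X.L) :
    Submodule.span F (Set.range b) = ⊤ := by
  rw [← h.span_field, X.span_L]

lemma finiteDimensional {ι : Type*} [Finite ι] {b : ι → X.V} (h : IsLatticeBasis F b X.L) :
    FiniteDimensional F X.V :=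
  ⟨span_range_field h ▸ Submodule.fg_span (Set.finite_range b)⟩

/-- The image of a basis of `X` under `φ` is a basis of `φ(φ^*L)`. -/
lemma isLatticeBasis_frobLattice (hσ : ∀ a : R, ∃ b : R, σ (algebraMap R F a) = algebraMap R F b)
    {ι : Type*} [Fintype ι] {b : ι → X.V} (h : IsLatticeBasis F b X.L) :
    IsLatticeBasis F (fun i => X.φ (b i)) X.frobLattice where
  linearIndependent := by
    -- Since `σ` need not be surjective, an injective semilinear map may destroy independence.
    -- Surjectivity of φ gives spanning, and a dimension count does the rest.
    refine linearIndependent_of_top_le_span_of_card_eq_finrank ?_ ?_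
    · intro y _
      obtain ⟨x, rfl⟩ := X.φ_bijective.surjective y
      have hx : x ∈ Submodule.span F (Set.range b) := span_range_field h ▸ Submodule.mem_top
      obtain ⟨c, rfl⟩ := Submodule.mem_span_range_iff_exists_fun _ |>.1 hx
      rw [map_sum]
      refine sum_mem fun i _ => ?_
      rw [map_smulₛₗ]
      exact Submodule.smul_mem _ _ (Submodule.subset_span ⟨i, rfl⟩)
    · rw [← h.finrank_field_eq, X.span_L, finrank_top]
  span_eq := by
    refine le_antisymm (Submodule.span_le.2 ?_) (Submodule.span_le.2 ?_)
    · rintro _ ⟨i, rfl⟩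
      exact Submodule.subset_span ⟨b i, h.mem i, rfl⟩
    · rintro _ ⟨x, hx, rfl⟩
      obtain ⟨c, rfl⟩ := (h.mem_iff x).1 hx
      rw [map_sum]
      refine sum_mem fun i _ => ?_
      obtain ⟨a, ha⟩ := hσ (c i)
      rw [map_smulₛₗ, ha, algebraMap_smul]
      exact Submodule.smul_mem _ _ (Submodule.subset_span ⟨i, rfl⟩)

lemma rank_eq {ι : Type*} [Fintype ι] {b : ι → X.V} (h : IsLatticeBasis F b X.L) :
    X.rank = Fintype.card ι :=
  h.finrank_eq

lemma exists_map_algebraMap (h : IsFrobeniusNorm R σ q nrm ϖ) (a : R) :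
    ∃ b : R, σ (algebraMap R F a) = algebraMap R F b := by
  obtain ⟨b, hb⟩ := (h.le_one_iff (σ (algebraMap R F a))).1 (by
    rw [h.map_frob]
    exact pow_le_one₀ (h.nonneg _) (h.map_algebraMap_le_one _))
  exact ⟨b, hb.symm⟩

-- The vectors `φ (b j)` again span `V`, so the basis `b` can be expressed through them, which
-- inverts `A`.
open Matrix in
lemma IsFrobMatrix.det_ne_zero (h : IsFrobeniusNorm R σ q nrm ϖ) {ι : Type*} [Fintype ι]
    [DecidableEq ι] {b : ι → X.V} {A : Matrix ι ι F} (hA : X.IsFrobMatrix b A) : A.det ≠ 0 := by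
  have h1 := isLatticeBasis_frobLattice (exists_map_algebraMap h) hA.isBasis
  have h2 : ∀ j, b j ∈ Submodule.span F (X.frobLattice : Set X.V) := by
    intro j
    rw [h1.span_field]
    have : Submodule.span F (Set.range fun i => X.φ (b i)) = ⊤ := by
      have := finiteDimensional hA.isBasis
      refine Submodule.eq_top_of_finrank_eq ?_
      rw [finrank_span_eq_card h1.linearIndependent, ← hA.isBasis.finrank_field_eq, X.span_L,
        finrank_top]
    rw [this]
    trivial
  obtain ⟨A', hA'⟩ := h1.exists_matrix_field h2
  have h3 : A * A' = 1 := by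
    refine hA.isBasis.linearIndependent.matrix_ext fun j => ?_
    rw [← sum_smul_sum_smul]
    simp_rw [← hA.map_eq, ← hA', one_apply, ite_smul, one_smul, zero_smul]
    simp
  intro h0
  have := congrArg det h3
  rw [det_mul, h0, zero_mul, det_one] at this
  exact zero_ne_one this

open Matrix in
/-- An isogeny of `φ`-modules increases the norm of the determinant of `φ`. -/
lemma IsFrobMatrix.norm_det_le (h : IsFrobeniusNorm R σ q nrm ϖ)
    {Y Z : PhiModule.{uR, uF, uV} R F σ} {ι : Type*} [Fintype ι]
    [DecidableEq ι] {b : ι → Y.V} {A : Matrix ι ι F} (hA : Y.IsFrobMatrix b A) {c : ι → Z.V}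
    {B : Matrix ι ι F} (hB : Z.IsFrobMatrix c B) (f : Y.V →ₗ[F] Z.V) (hf : Function.Injective f)
    (hφ : ∀ x, f (Y.φ x) = Z.φ (f x)) (hL : ∀ x ∈ Y.L, f x ∈ Z.L) : nrm A.det ≤ nrm B.det := by
  obtain ⟨P, hP⟩ := hB.isBasis.exists_matrix fun j => hL _ (hA.isBasis.mem j)
  -- Compatibility of `f` with φ in coordinates; the twist by `σ` reflects semilinearity. With `|σ
  -- x| = |x|^q`, determinants give `|det A| = |det B| |det P|^(q-1)`, where `|det P| ≤ 1`.
  have h1 : P.map (algebraMap R F) * A = B * (P.map (algebraMap R F)).map σ := by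
    refine hB.isBasis.linearIndependent.matrix_ext fun j => ?_
    rw [← sum_smul_sum_smul, ← sum_smul_sum_smul]
    simp_rw [← hP, ← hB.map_eq]
    have h2 : ∑ k, A k j • f (b k) = f (Y.φ (b j)) := by simp [hA.map_eq]
    rw [h2, hφ, hP, map_sum]
    simp_rw [map_smulₛₗ]
    rfl
  have hP0 : (P.map (algebraMap R F)).det ≠ 0 := by
    intro h0
    obtain ⟨v, hv, hv0⟩ := exists_mulVec_eq_zero_iff.2 h0
    have h2 : ∑ j, v j • f (b j) = 0 := by
      simp_rw [hP, Finset.smul_sum, smul_smul]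
      rw [Finset.sum_comm]
      refine Finset.sum_eq_zero fun i _ => ?_
      rw [← Finset.sum_smul]
      have := congrFun hv0 i
      rw [mulVec, dotProduct] at this
      simp_rw [mul_comm (v _), this]
      simp
    have h3 : f (∑ j, v j • b j) = 0 := by simpa using h2
    exact hv (funext (Fintype.linearIndependent_iff.1 hA.isBasis.linearIndependent v
      (hf (h3.trans (map_zero f).symm))))
  have h2 := congrArg (fun M => nrm (det M)) h1
  simp only [det_mul, h.map_mul] at h2
  have h3 : ((P.map (algebraMap R F)).map σ).det = σ (P.map (algebraMap R F)).det :=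
    (RingHom.map_det σ _).symm
  rw [h3, h.map_frob, mul_comm] at h2
  have h4 : nrm (P.map (algebraMap R F)).det ≤ 1 := by
    have : (P.map (algebraMap R F)).det = algebraMap R F P.det := (RingHom.map_det _ _).symm
    rw [this]
    exact h.map_algebraMap_le_one _
  have h5 := h.pos _ hP0
  refine le_of_mul_le_mul_right (h2.le.trans ?_) h5
  refine mul_le_mul_of_nonneg_left ?_ (h.nonneg _)
  exact pow_le_of_le_one h5.le h4 (by have := h.one_lt; omega)

end PhiModule


/-! ### Hodge bases and the determinant formula for the degree -/

namespace PhiModule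

universe uR uF uV

variable {R : Type uR} {F : Type uF} [CommRing R] [IsDomain R] [Field F] [Algebra R F]
  [IsFractionRing R F] {σ : F →+* F} {q : ℕ} {nrm : F → ℝ} {ϖ : F}
  {X : PhiModule.{uR, uF, uV} R F σ}

/-- Bases adapted to the lattices `L` and `φ(φ^*L)`. -/
structure IsHodgeBasis (X : PhiModule.{uR, uF, uV} R F σ) (q : ℕ) (nrm : F → ℝ)
    (e : Fin X.rank → X.V) (l : Fin X.rank → F) (C : Matrix (Fin X.rank) (Fin X.rank) R) :
    Prop where
  ne_zero : ∀ i, l i ≠ 0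
  isBasis_frob : IsLatticeBasis F (fun i => l i • e i) X.frobLattice
  isUnit_det : IsUnit C.det
  isFrobMatrix : X.IsFrobMatrix e (Matrix.diagonal l * C.map (algebraMap R F))
  antitone : Antitone fun i => Real.logb q (nrm (l i))

open Matrix in
lemma exists_isHodgeBasis [ValuationRing R] (h : IsFrobeniusNorm R σ q nrm ϖ) (hfg : X.L.FG) :
    ∃ e l C, X.IsHodgeBasis q nrm e l C := by
  obtain ⟨b, hb⟩ := exists_isLatticeBasis (F := F) hfg
  change Fin X.rank → X.V at b
  have hσ := exists_map_algebraMap h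
  obtain ⟨e₀, l₀, he₀, hl₀, hel₀⟩ := hb.exists_adapted (isLatticeBasis_frobLattice hσ hb)
    (fun j => by rw [X.span_L]; trivial)
  -- Sorting the negatives in increasing order makes the logarithms non-increasing, as a type
  -- requires.
  set s := Tuple.sort fun i => -Real.logb q (nrm (l₀ i)) with hs
  set e := e₀ ∘ s with he
  set l := l₀ ∘ s with hl
  have hl' : ∀ i, l i ≠ 0 := fun i => hl₀ _
  have he' : IsLatticeBasis F e X.L := he₀.reindex s
  have hel : IsLatticeBasis F (fun i => l i • e i) X.frobLattice := hel₀.reindex s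
  have hφ := isLatticeBasis_frobLattice hσ he'
  obtain ⟨C, hC⟩ := hel.exists_matrix hφ.mem
  obtain ⟨C', hC'⟩ := hφ.exists_matrix hel.mem
  -- `C` compares two bases of the same lattice `φ(φ^*L)`, hence it is unimodular.
  have hCC : C * C' = 1 := by
    have h1 : (C * C').map (algebraMap R F) = (1 : Matrix _ _ F) := by
      rw [Matrix.map_mul]
      refine hel.linearIndependent.matrix_ext fun j => ?_
      rw [← sum_smul_sum_smul]
      simp_rw [← hC, ← hC', one_apply, ite_smul, one_smul, zero_smul]
      simp
    ext i j
    refine IsFractionRing.injective R F ?_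
    have := congrFun (congrFun h1 i) j
    rw [map_apply] at this
    rw [this]
    simp [one_apply, apply_ite (algebraMap R F)]
  refine ⟨e, l, C, hl', hel, ?_, ⟨he', fun j => ?_⟩, ?_⟩
  · exact IsUnit.of_mul_eq_one C'.det (by rw [← det_mul, hCC, det_one])
  · rw [hC]
    refine Finset.sum_congr rfl fun i _ => ?_
    rw [smul_smul, diagonal_mul, mul_comm]
  · have := Tuple.monotone_sort fun i => -Real.logb q (nrm (l₀ i))
    intro i j hij
    exact neg_le_neg_iff.1 (this hij)

lemma IsHodgeBasis.norm_det (h : IsNormOfRing R nrm) {e l C} (H : X.IsHodgeBasis q nrm e l C) :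
    nrm (Matrix.diagonal l * C.map (algebraMap R F)).det = ∏ i, nrm (l i) := by
  have : (C.map (algebraMap R F)).det = algebraMap R F C.det := (RingHom.map_det _ _).symm
  rw [Matrix.det_mul, Matrix.det_diagonal, this, h.map_mul, h.map_isUnit H.isUnit_det, mul_one,
    h.map_prod]

lemma exists_twisted_le (h : IsFrobeniusNorm R σ q nrm ϖ) {e l C}
    (H : X.IsHodgeBasis q nrm e l C) :
    {n : ℕ | X.twistedFrobLattice q ϖ n ≤ X.L}.Nonempty := by
  have hq : (1 : ℝ) < q := by exact_mod_cast h.one_lt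
  have hϖ := h.norm_unif
  have hlim : Filter.Tendsto (fun n : ℕ => ((q : ℝ)⁻¹) ^ n) Filter.atTop (nhds 0) :=
    tendsto_pow_atTop_nhds_zero_of_lt_one (by positivity) (inv_lt_one_of_one_lt₀ hq)
  have hev : ∀ᶠ n : ℕ in Filter.atTop, ∀ i, ((q : ℝ)⁻¹) ^ n * nrm (l i) ≤ 1 := by
    rw [Filter.eventually_all]
    intro i
    have h1 := hlim.mul_const (nrm (l i))
    rw [zero_mul] at h1
    exact (h1.eventually (gt_mem_nhds one_pos)).mono fun n hn => hn.le
  obtain ⟨n, hn⟩ := hev.exists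
  refine ⟨n, ?_⟩
  rw [Set.mem_ofPred_eq, twistedFrobLattice, Submodule.map_le_iff_le_comap, ← H.isBasis_frob.span_eq,
    Submodule.span_le]
  rintro _ ⟨i, rfl⟩
  obtain ⟨a, ha⟩ := (h.le_one_iff (ϖ ^ (q * n) * l i)).1 (by
    rw [h.map_mul, pow_mul, h.map_pow, hϖ]
    exact hn i)
  change ϖ ^ (q * n) • l i • e i ∈ X.L
  rw [smul_smul, ← ha, algebraMap_smul]
  exact X.L.smul_mem _ (H.isFrobMatrix.isBasis.mem i)

/-- The quotient of a lattice by a sublattice with an adapted basis. -/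
lemma isLength_of_adapted {n : ℕ} {V : Type*} [AddCommGroup V] [Module F V] [Module R V]
    [IsScalarTower R F V] {e : Fin n → V} {N N' : Submodule R V} (he : IsLatticeBasis F e N)
    (x : Fin n → R) (hx : ∀ i, x i ≠ 0)
    (hN' : Submodule.span R (Set.range fun i => x i • e i) = N') :
    IsLength (R := R) q nrm (N ⧸ N'.submoduleOf N)
      (- ∑ i, Real.logb q (nrm (algebraMap R F (x i)))) := by
  refine ⟨n, x, hx, ⟨?_⟩, rfl⟩
  let f : N →ₗ[R] ((i : Fin n) → R ⧸ Ideal.span {x i}) :=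
    LinearMap.pi fun i => (Ideal.span {x i}).mkQ ∘ₗ he.basis.coord i
  have hf : Function.Surjective f := by
    intro z
    choose w hw using fun i => Submodule.mkQ_surjective _ (z i)
    refine ⟨∑ i, w i • he.basis i, funext fun i => ?_⟩
    rw [← hw i, LinearMap.pi_apply, LinearMap.comp_apply, Module.Basis.coord_apply,
      Module.Basis.repr_sum_self]
  have hker : N'.submoduleOf N = LinearMap.ker f := by
    ext z
    have hz : (z : V) = ∑ i, he.basis.coord i z • e i := by
      calc (z : V) = N.subtype (∑ i, he.basis.repr z i • he.basis i) := by
            rw [he.basis.sum_repr, Submodule.subtype_apply]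
        _ = _ := by
            rw [map_sum]
            exact Finset.sum_congr rfl fun i _ => by simp
    rw [LinearMap.mem_ker, funext_iff]
    simp only [f, LinearMap.pi_apply, LinearMap.comp_apply, Submodule.mkQ_apply, Pi.zero_apply,
      Submodule.Quotient.mk_eq_zero, Ideal.mem_span_singleton']
    rw [Submodule.submoduleOf, Submodule.mem_comap, Submodule.subtype_apply, ← hN',
      Submodule.mem_span_range_iff_exists_fun]
    constructor
    · rintro ⟨c, hc⟩ i
      refine ⟨c i, ?_⟩
      rw [hz, ← sub_eq_zero, ← Finset.sum_sub_distrib] at hc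
      simp_rw [smul_smul, ← sub_smul] at hc
      exact sub_eq_zero.1 (Fintype.linearIndependent_iff.1 he.linearIndependent_ring _ hc i)
    · intro hc
      choose c hc using hc
      refine ⟨c, ?_⟩
      rw [hz]
      simp_rw [smul_smul, hc]
  exact (Submodule.quotEquivOfEq _ _ hker).trans (f.quotKerEquivOfSurjective hf)

/-- In adapted bases the torsion quotient is the sum of the `R/(ϖ^(qn) l_i)`. As `|ϖ^q| = 1/q`, each
summand has length `n - log_q |l_i|`, and the terms in `n` cancel. -/
lemma deg_eq_sum (h : IsFrobeniusNorm R σ q nrm ϖ) {e l C} (H : X.IsHodgeBasis q nrm e l C) :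
    X.deg q nrm ϖ = ∑ i, Real.logb q (nrm (l i)) := by
  have hq : (1 : ℝ) < q := by exact_mod_cast h.one_lt
  have hϖ := h.norm_unif
  have hϖ0 : ϖ ≠ 0 := by
    rintro rfl
    have := h.map_unif
    rw [zero_pow (by have := h.one_lt; omega), h.map_zero, mul_zero] at this
    exact zero_ne_one this
  have hmem := Nat.sInf_mem (exists_twisted_le h H)
  rw [deg]
  set n := sInf {n : ℕ | X.twistedFrobLattice q ϖ n ≤ X.L}
  rw [Set.mem_ofPred_eq] at hmem
  have hx : ∀ i, ∃ a : R, algebraMap R F a = ϖ ^ (q * n) * l i := by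
    intro i
    have h1 : ϖ ^ (q * n) • l i • e i ∈ X.L := hmem ⟨_, H.isBasis_frob.mem i, rfl⟩
    obtain ⟨c, hc⟩ := (H.isFrobMatrix.isBasis.mem_iff _).1 h1
    refine ⟨c i, ?_⟩
    have h2 : ∑ j, (algebraMap R F (c j) - if j = i then ϖ ^ (q * n) * l i else 0) • e j = 0 := by
      simp_rw [sub_smul, Finset.sum_sub_distrib, hc, ite_smul, zero_smul, Finset.sum_ite_eq',
        Finset.mem_univ, if_true, smul_smul, sub_self]
    have h3 := Fintype.linearIndependent_iff.1 H.isFrobMatrix.isBasis.linearIndependent _ h2 i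
    rwa [if_pos rfl, sub_eq_zero] at h3
  choose x hx using hx
  have hx0 : ∀ i, x i ≠ 0 := by
    intro i h0
    have := hx i
    rw [h0, map_zero] at this
    exact mul_ne_zero (pow_ne_zero _ hϖ0) (H.ne_zero i) this.symm
  have hlen := isLength_of_adapted (q := q) (nrm := nrm) (N' := X.twistedFrobLattice q ϖ n)
    H.isFrobMatrix.isBasis x hx0 (by
      rw [twistedFrobLattice, ← H.isBasis_frob.span_eq, Submodule.map_span, ← Set.range_comp]
      congr 2
      funext i
      change _ = ϖ ^ (q * n) • l i • e i
      rw [smul_smul, ← hx, algebraMap_smul])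
  rw [h.normLength_eq hlen]
  have h4 : ∀ i, Real.logb q (nrm (algebraMap R F (x i))) = -n + Real.logb q (nrm (l i)) := by
    intro i
    rw [hx, h.map_mul, pow_mul, h.map_pow, hϖ, Real.logb_mul (by positivity)
      (h.pos _ (H.ne_zero i)).ne', inv_pow, Real.logb_inv, Real.logb_pow,
      Real.logb_self_eq_one hq, mul_one]
  simp_rw [h4, Finset.sum_add_distrib]
  simp
  ring

variable [ValuationRing R]

/-- The degree of `X` is the logarithm of the norm of the determinant of `φ` in a basis. -/
theorem deg_eq (h : IsFrobeniusNorm R σ q nrm ϖ) {ι : Type*} [Fintype ι] [DecidableEq ι]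
    {b : ι → X.V} {A : Matrix ι ι F} (hA : X.IsFrobMatrix b A) :
    X.deg q nrm ϖ = Real.logb q (nrm A.det) := by
  have hfg : X.L.FG := hA.isBasis.span_eq ▸ Submodule.fg_span (Set.finite_range b)
  obtain ⟨e, l, C, H⟩ := exists_isHodgeBasis h hfg
  let s : ι ≃ Fin X.rank := Fintype.equivFinOfCardEq (rank_eq hA.isBasis).symm
  have hA' := hA.reindex s.symm
  -- The identity is an isogeny in both directions, so the norm of the determinant does not depend
  -- on the basis.
  have hdet : nrm A.det = ∏ i, nrm (l i) := by
    rw [← H.norm_det h.toIsNormOfRing, ← Matrix.det_submatrix_equiv_self s.symm A]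
    exact le_antisymm
      (hA'.norm_det_le h H.isFrobMatrix LinearMap.id Function.injective_id (fun _ => rfl)
        fun _ hx => hx)
      (H.isFrobMatrix.norm_det_le h hA' LinearMap.id Function.injective_id (fun _ => rfl)
        fun _ hx => hx)
  rw [deg_eq_sum h H, hdet, Real.logb_prod]
  exact fun i _ => (h.pos _ (H.ne_zero i)).ne'

lemma exists_isFrobMatrix (hfg : X.L.FG) :
    ∃ (b : Fin X.rank → X.V) (A : Matrix (Fin X.rank) (Fin X.rank) F), X.IsFrobMatrix b A := by
  obtain ⟨b, hb⟩ := exists_isLatticeBasis (F := F) hfg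
  obtain ⟨A, hA⟩ := hb.exists_matrix_field (c := fun j => X.φ (b j))
    fun j => by rw [X.span_L]; trivial
  exact ⟨b, A, hb, hA⟩

/-- Isogenies increase the degree. -/
theorem deg_le_deg (h : IsFrobeniusNorm R σ q nrm ϖ) {Y Z : PhiModule.{uR, uF, uV} R F σ}
    (hY : Y.L.FG) (hZ : Z.L.FG) (hr : Y.rank = Z.rank) (f : Y.V →ₗ[F] Z.V)
    (hf : Function.Injective f) (hφ : ∀ x, f (Y.φ x) = Z.φ (f x)) (hL : ∀ x ∈ Y.L, f x ∈ Z.L) :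
    Y.deg q nrm ϖ ≤ Z.deg q nrm ϖ := by
  obtain ⟨b, A, hA⟩ := exists_isFrobMatrix hY
  obtain ⟨c, B, hB⟩ := exists_isFrobMatrix hZ
  rw [deg_eq h hA, deg_eq h hB, ← Matrix.det_submatrix_equiv_self (finCongr hr) B]
  exact Real.logb_le_logb_of_le (by exact_mod_cast h.one_lt) (h.pos _ (hA.det_ne_zero h))
    (hA.norm_det_le h (hB.reindex (finCongr hr)) f hf hφ hL)

/-- The degree is invariant under isomorphisms. -/
theorem deg_eq_deg (h : IsFrobeniusNorm R σ q nrm ϖ) {Y Z : PhiModule.{uR, uF, uV} R F σ}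
    (hY : Y.L.FG) (hZ : Z.L.FG) (e : Y.V ≃ₗ[F] Z.V)
    (hφ : ∀ x, e (Y.φ x) = Z.φ (e x)) (hL : ∀ x, x ∈ Y.L ↔ e x ∈ Z.L) :
    Y.rank = Z.rank ∧ Y.deg q nrm ϖ = Z.deg q nrm ϖ := by
  obtain ⟨b, A, hA⟩ := exists_isFrobMatrix hY
  obtain ⟨c, B, hB⟩ := exists_isFrobMatrix hZ
  have hr : Y.rank = Z.rank := by
    rw [rank_eq hA.isBasis, rank_eq hB.isBasis, ← hA.isBasis.finrank_field_eq,
      ← hB.isBasis.finrank_field_eq, Y.span_L, Z.span_L, finrank_top, finrank_top,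
      e.finrank_eq]
  refine ⟨hr, le_antisymm
    (deg_le_deg h hY hZ hr e.toLinearMap e.injective hφ fun x => (hL x).1)
    (deg_le_deg h hZ hY hr.symm e.symm.toLinearMap e.symm.injective (fun x => ?_) fun x hx => ?_)⟩
  · obtain ⟨y, rfl⟩ := e.surjective x
    rw [← hφ]
    simp
  · obtain ⟨y, rfl⟩ := e.surjective x
    simpa [hL] using hx

end PhiModule


/-! ## Strict subobjects -/

namespace PhiModule

universe uR uF uV

variable {R : Type uR} {F : Type uF} [CommRing R] [IsDomain R] [Field F] [Algebra R F]
  [IsFractionRing R F] {σ : F →+* F} {q : ℕ} {nrm : F → ℝ} {ϖ : F}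
  {X : PhiModule.{uR, uF, uV} R F σ}

section Maps

/-- The inclusion of a strict subobject. -/
def subIncl (N : X.StrictSub) : (X.sub N).V →ₗ[F] X.V :=
  (Submodule.span F (N.N : Set X.V)).subtype

/-- The projection from a strict subobject to a subquotient. -/
def grMk (N N' : X.StrictSub) : (X.sub N).V →ₗ[F] (X.gr N N').V :=
  ((Submodule.span F (N'.N : Set X.V)).submoduleOf (Submodule.span F (N.N : Set X.V))).mkQ

/-- The subspace spanned by a strict subobject. -/
def StrictSub.space (N : X.StrictSub) : Submodule F X.V := Submodule.span F (N.N : Set X.V)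

variable (N N' : X.StrictSub)

lemma subIncl_injective : Function.Injective (subIncl N) := Subtype.val_injective

lemma subIncl_mem (x : (X.sub N).V) : subIncl N x ∈ N.space := x.2

lemma exists_subIncl_eq {x : X.V} (hx : x ∈ N.space) : ∃ y, subIncl N y = x := ⟨⟨x, hx⟩, rfl⟩

lemma subIncl_φ (x : (X.sub N).V) : subIncl N ((X.sub N).φ x) = X.φ (subIncl N x) := rfl

lemma mem_sub_L (x : (X.sub N).V) :
    x ∈ (X.sub N).L ↔ subIncl N x ∈ N.N := Iff.rfl

lemma grMk_surjective : Function.Surjective (grMk N N') :=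
  Submodule.mkQ_surjective
    ((Submodule.span F (N'.N : Set X.V)).submoduleOf (Submodule.span F (N.N : Set X.V)))

lemma grMk_eq_zero_iff (x : (X.sub N).V) : grMk N N' x = 0 ↔ subIncl N x ∈ N'.space :=
  Submodule.Quotient.mk_eq_zero _

lemma grMk_φ (x : (X.sub N).V) : grMk N N' ((X.sub N).φ x) = (X.gr N N').φ (grMk N N' x) := rfl

lemma mem_gr_L (y : (X.gr N N').V) : y ∈ (X.gr N N').L ↔ ∃ x ∈ (X.sub N).L, grMk N N' x = y :=
  Iff.rfl

end Maps

/-! ### Strict subobjects as stable subspaces -/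

namespace StrictSub

lemma smul_mem_iff {W : Submodule F X.V} {a : R} (ha : a ≠ 0) (x : X.V) :
    a • x ∈ W ↔ x ∈ W := by
  rw [← algebraMap_smul F a x]
  exact W.smul_mem_iff (by simpa using ha)

/-- Any vector of the span has a nonzero integral multiple in `N`; saturation divides this multiple
back. Hence a strict subobject is determined by its span. -/
lemma mem_N_iff (N : X.StrictSub) (x : X.V) : x ∈ N.N ↔ x ∈ X.L ∧ x ∈ N.space := by
  refine ⟨fun hx => ⟨N.le hx, Submodule.subset_span hx⟩, fun ⟨hL, hx⟩ => ?_⟩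
  obtain ⟨y, rfl⟩ := exists_subIncl_eq N hx
  obtain ⟨a, ha, hy⟩ := exists_smul_mem_L y
  exact N.saturated a _ ha hL hy

lemma isStable_space (N : X.StrictSub) : X.IsStable N.space := N.stable

lemma le_iff_space_le {N N' : X.StrictSub} : N ≤ N' ↔ N.space ≤ N'.space := by
  refine ⟨fun h => Submodule.span_mono h, fun h x hx => ?_⟩
  rw [mem_N_iff] at hx ⊢
  exact ⟨hx.1, h hx.2⟩

lemma ext_space {N N' : X.StrictSub} (h : N.space = N'.space) : N = N' :=
  le_antisymm (le_iff_space_le.2 h.le) (le_iff_space_le.2 h.ge)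

lemma span_L_inf (W : Submodule F X.V) :
    Submodule.span F ((X.L ⊓ W.restrictScalars R : Submodule R X.V) : Set X.V) = W := by
  refine le_antisymm (Submodule.span_le.2 fun x hx => hx.2) fun x hx => ?_
  obtain ⟨a, ha, hax⟩ := exists_smul_mem_L x
  exact (smul_mem_iff ha x).1 (Submodule.subset_span ⟨hax, (smul_mem_iff ha x).2 hx⟩)

/-- The strict subobject attached to a stable subspace. -/
def ofSpace (W : Submodule F X.V) (hW : X.IsStable W) : X.StrictSub where
  N := X.L ⊓ W.restrictScalars R
  le := inf_le_left
  saturated a x ha hx hax := ⟨hx, (smul_mem_iff ha x).1 hax.2⟩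
  stable := by rwa [span_L_inf]

@[simp] lemma space_ofSpace (W : Submodule F X.V) (hW : X.IsStable W) :
    (ofSpace W hW).space = W := span_L_inf W

lemma isStable_inf {W W' : Submodule F X.V} (h : X.IsStable W) (h' : X.IsStable W') :
    X.IsStable (W ⊓ W') := fun x => and_congr (h x) (h' x)

lemma isStable_sup {W W' : Submodule F X.V} (h : X.IsStable W) (h' : X.IsStable W') :
    X.IsStable (W ⊔ W') := by
  intro x
  constructor
  · intro hx
    obtain ⟨y, hy, z, hz, hyz⟩ := Submodule.mem_sup.1 hx
    obtain ⟨y, rfl⟩ := X.φ_bijective.surjective y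
    obtain ⟨z, rfl⟩ := X.φ_bijective.surjective z
    rw [← map_add] at hyz
    rw [← X.φ_bijective.injective hyz]
    exact Submodule.add_mem_sup ((h y).1 hy) ((h' z).1 hz)
  · intro hx
    obtain ⟨y, hy, z, hz, rfl⟩ := Submodule.mem_sup.1 hx
    rw [map_add]
    exact Submodule.add_mem_sup ((h y).2 hy) ((h' z).2 hz)

/-- The operations are those of stable subspaces; in particular the join is the saturation of the
sum of lattices, which may be strictly larger than the sum. -/
instance : Lattice X.StrictSub where
  sup N N' := ofSpace (N.space ⊔ N'.space) (isStable_sup N.isStable_space N'.isStable_space)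
  inf N N' := ofSpace (N.space ⊓ N'.space) (isStable_inf N.isStable_space N'.isStable_space)
  le_sup_left N N' := by
    rw [le_iff_space_le, space_ofSpace]
    exact le_sup_left
  le_sup_right N N' := by
    rw [le_iff_space_le, space_ofSpace]
    exact le_sup_right
  sup_le N N' N'' h h' := by
    rw [le_iff_space_le] at *
    rw [space_ofSpace]
    exact sup_le h h'
  inf_le_left N N' := by
    rw [le_iff_space_le, space_ofSpace]
    exact inf_le_left
  inf_le_right N N' := by
    rw [le_iff_space_le, space_ofSpace]
    exact inf_le_right
  le_inf N N' N'' h h' := by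
    rw [le_iff_space_le] at *
    rw [space_ofSpace]
    exact le_inf h h'

lemma space_sup (N N' : X.StrictSub) : (N ⊔ N').space = N.space ⊔ N'.space := space_ofSpace _ _

lemma space_inf (N N' : X.StrictSub) : (N ⊓ N').space = N.space ⊓ N'.space := space_ofSpace _ _

lemma space_bot : (⊥ : X.StrictSub).space = ⊥ := by
  change Submodule.span F ((⊥ : Submodule R X.V) : Set X.V) = ⊥
  simp

lemma space_top : (⊤ : X.StrictSub).space = ⊤ := X.span_L

end StrictSub

lemma fg_N [ValuationRing R] (hfg : X.L.FG) (N : X.StrictSub) : N.N.FG :=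
  (exists_isLatticeBasis_sum (F := F) hfg N.le N.saturated).1

lemma fg_sub [ValuationRing R] (hfg : X.L.FG) (N : X.StrictSub) : (X.sub N).L.FG := by
  refine Submodule.fg_of_fg_map_injective ((subIncl N).restrictScalars R) (subIncl_injective N) ?_
  have : (X.sub N).L.map ((subIncl N).restrictScalars R) = N.N := by
    ext x
    constructor
    · rintro ⟨y, hy, rfl⟩
      exact hy
    · intro hx
      obtain ⟨y, rfl⟩ := exists_subIncl_eq N ((N.mem_N_iff x).1 hx).2
      exact ⟨y, hx, rfl⟩
  rw [this]
  exact fg_N hfg N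

lemma fg_gr [ValuationRing R] (hfg : X.L.FG) (N N' : X.StrictSub) : (X.gr N N').L.FG := by
  have : (X.gr N N').L = (X.sub N).L.map ((grMk N N').restrictScalars R) := rfl
  rw [this]
  exact (fg_sub hfg N).map _

lemma isLatticeBasis_sub {N : X.StrictSub} {ι : Type*} [Fintype ι] {b : ι → (X.sub N).V}
    (h : IsLatticeBasis F (fun i => subIncl N (b i)) N.N) : IsLatticeBasis F b (X.sub N).L where
  linearIndependent := h.linearIndependent.of_comp (subIncl N)
  span_eq := by
    ext x
    rw [mem_sub_L, h.mem_iff, Submodule.mem_span_range_iff_exists_fun]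
    refine exists_congr fun c => ?_
    rw [← (subIncl_injective N).eq_iff, map_sum]
    simp_rw [← algebraMap_smul F (_ : R) (_ : (X.sub N).V), map_smul]

lemma isLatticeBasis_gr {N N' : X.StrictSub} {ι κ : Type*} [Fintype ι] [Fintype κ]
    {b : ι ⊕ κ → (X.sub N).V} (h : IsLatticeBasis F b (X.sub N).L)
    (h' : IsLatticeBasis F (fun i => subIncl N (b (Sum.inl i))) N'.N) :
    IsLatticeBasis F (fun j => grMk N N' (b (Sum.inr j))) (X.gr N N').L where
  linearIndependent := by
    rw [Fintype.linearIndependent_iff]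
    intro g hg
    have h1 : grMk N N' (∑ j, g j • b (Sum.inr j)) = 0 := by simpa using hg
    rw [grMk_eq_zero_iff, StrictSub.space, h'.span_field,
      Submodule.mem_span_range_iff_exists_fun] at h1
    obtain ⟨c, hc⟩ := h1
    have h2 : ∑ j, g j • b (Sum.inr j) = ∑ i, c i • b (Sum.inl i) :=
      subIncl_injective N (by rw [← hc]; simp)
    have h3 : ∑ k, (Sum.elim (fun i => -c i) g) k • b k = 0 := by
      rw [Fintype.sum_sum_type]
      simp [h2]
    exact fun j => Fintype.linearIndependent_iff.1 h.linearIndependent _ h3 (Sum.inr j)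
  span_eq := by
    have h0 : ∀ i, grMk N N' (b (Sum.inl i)) = 0 := fun i =>
      (grMk_eq_zero_iff N N' _).2 (Submodule.subset_span (h'.mem i))
    refine le_antisymm (Submodule.span_le.2 ?_) fun y hy => ?_
    · rintro _ ⟨j, rfl⟩
      exact (mem_gr_L N N' _).2 ⟨_, h.mem _, rfl⟩
    · obtain ⟨x, hx, rfl⟩ := (mem_gr_L N N' _).1 hy
      obtain ⟨c, rfl⟩ := (h.mem_iff x).1 hx
      rw [Fintype.sum_sum_type, map_add, map_sum, map_sum]
      simp_rw [map_smul, h0, smul_zero, Finset.sum_const_zero, zero_add]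
      refine sum_mem fun j _ => ?_
      rw [algebraMap_smul]
      exact Submodule.smul_mem _ _ (Submodule.subset_span ⟨j, rfl⟩)

/-! ### Additivity and supermodularity -/

variable [ValuationRing R]

open Matrix in
/-- Bases adapted to strict subobjects `N' ≤ N`, in which `φ` is block triangular. -/
lemma exists_isFrobMatrix_fromBlocks (hfg : X.L.FG) {N N' : X.StrictSub} (hle : N' ≤ N) :
    ∃ (m n : ℕ) (b : Fin m ⊕ Fin n → (X.sub N).V) (b' : Fin m → (X.sub N').V)
      (A : Matrix (Fin m) (Fin m) F) (B : Matrix (Fin m) (Fin n) F) (D : Matrix (Fin n) (Fin n) F),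
      (X.sub N).IsFrobMatrix b (fromBlocks A B 0 D) ∧ (X.sub N').IsFrobMatrix b' A ∧
      (X.gr N N').IsFrobMatrix (fun j => grMk N N' (b (Sum.inr j))) D := by
  obtain ⟨-, m, n, c, hc, hc'⟩ := exists_isLatticeBasis_sum (F := F) (fg_N hfg N) hle
    fun a x ha hx => N'.saturated a x ha (N.le hx)
  choose b hb using fun i => exists_subIncl_eq N (Submodule.subset_span (hc.mem i) : c i ∈ N.space)
  choose b' hb' using fun i =>
    exists_subIncl_eq N' (Submodule.subset_span (hc'.mem i) : c (Sum.inl i) ∈ N'.space)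
  obtain rfl : (fun i => subIncl N (b i)) = c := funext hb
  replace hb' : ∀ i, subIncl N' (b' i) = subIncl N (b (Sum.inl i)) := hb'
  have hbL := isLatticeBasis_sub hc
  have hbL' : IsLatticeBasis F b' (X.sub N').L := by
    refine isLatticeBasis_sub ?_
    simp_rw [hb']
    exact hc'
  obtain ⟨M, hM⟩ := hbL.exists_matrix_field (c := fun j => (X.sub N).φ (b j))
    fun j => by rw [(X.sub N).span_L]; trivial
  obtain ⟨A, hA⟩ := hbL'.exists_matrix_field (c := fun j => (X.sub N').φ (b' j))
    fun j => by rw [(X.sub N').span_L]; trivial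
  -- Stability of `N'` kills the lower left block and identifies the upper left one with the matrix
  -- of φ on `N'`.
  have hMA : (of fun i j => M i (Sum.inl j) : Matrix (Fin m ⊕ Fin n) (Fin m) F) =
      fromRows A 0 := by
    refine hbL.linearIndependent.matrix_ext fun j => subIncl_injective N ?_
    have h1 := congrArg (subIncl N) (hM (Sum.inl j))
    have h2 := congrArg (subIncl N') (hA j)
    rw [subIncl_φ, ← hb', ← subIncl_φ, h2] at h1
    change subIncl N (∑ i, M i (Sum.inl j) • b i) = _
    rw [← h1, Fintype.sum_sum_type]
    simp [hb']
  have hM' : M = fromBlocks A M.toBlocks₁₂ 0 M.toBlocks₂₂ := by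
    ext (i | i) (j | j)
    · exact congrFun (congrFun hMA (Sum.inl i)) j
    · rfl
    · exact congrFun (congrFun hMA (Sum.inr i)) j
    · rfl
  refine ⟨m, n, b, b', A, M.toBlocks₁₂, M.toBlocks₂₂, ⟨hbL, by rwa [← hM']⟩, ⟨hbL', hA⟩, isLatticeBasis_gr hbL hc', ?_⟩
  intro j
  have h0 : ∀ i, grMk N N' (b (Sum.inl i)) = 0 := fun i =>
    (grMk_eq_zero_iff N N' _).2 (Submodule.subset_span (hc'.mem i))
  rw [← grMk_φ, hM, Fintype.sum_sum_type, map_add, map_sum, map_sum]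
  simp [h0, toBlocks₂₂]

/-- The rank and the degree are additive. -/
theorem rank_add_rank_gr (h : IsFrobeniusNorm R σ q nrm ϖ) (hfg : X.L.FG) {N N' : X.StrictSub}
    (hle : N' ≤ N) :
    (X.sub N').rank + (X.gr N N').rank = (X.sub N).rank ∧
    (X.sub N').deg q nrm ϖ + (X.gr N N').deg q nrm ϖ = (X.sub N).deg q nrm ϖ := by
  obtain ⟨m, n, b, b', A, B, D, hM, hA, hD⟩ := exists_isFrobMatrix_fromBlocks hfg hle
  refine ⟨?_, ?_⟩
  · rw [rank_eq hM.isBasis, rank_eq hA.isBasis, rank_eq hD.isBasis, Fintype.card_sum]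
  · rw [deg_eq h hM, deg_eq h hA, deg_eq h hD, Matrix.det_fromBlocks_zero₂₁, h.map_mul,
      Real.logb_mul (h.pos _ (hA.det_ne_zero h)).ne' (h.pos _ (hD.det_ne_zero h)).ne']

lemma rank_sub_eq (hfg : X.L.FG) (N : X.StrictSub) :
    (X.sub N).rank = Module.finrank F N.space := by
  obtain ⟨b, hb⟩ := exists_isLatticeBasis (F := F) (fg_N hfg N)
  choose c hc using fun i => exists_subIncl_eq N (Submodule.subset_span (hb.mem i) : b i ∈ N.space)
  obtain rfl : (fun i => subIncl N (c i)) = b := funext hc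
  rw [rank_eq (isLatticeBasis_sub hb), StrictSub.space, hb.finrank_field_eq]

lemma finiteDimensional_of_fg (hfg : X.L.FG) : FiniteDimensional F X.V := by
  obtain ⟨b, hb⟩ := exists_isLatticeBasis (F := F) hfg
  exact finiteDimensional hb

/-- The comparison of `N/(N ∩ N')` with `(N + N')/N'`. -/
lemma deg_gr_inf_le_deg_gr_sup (h : IsFrobeniusNorm R σ q nrm ϖ) (hfg : X.L.FG)
    (N N' : X.StrictSub) (hr : (X.gr N (N ⊓ N')).rank = (X.gr (N ⊔ N') N').rank) :
    (X.gr N (N ⊓ N')).deg q nrm ϖ ≤ (X.gr (N ⊔ N') N').deg q nrm ϖ := by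
  have hle : N.space ≤ (N ⊔ N').space := StrictSub.le_iff_space_le.1 le_sup_left
  let i : (X.sub N).V →ₗ[F] (X.sub (N ⊔ N')).V := Submodule.inclusion hle
  have hi : ∀ x, subIncl (N ⊔ N') (i x) = subIncl N x := fun x => rfl
  have hker : ∀ x, (grMk (N ⊔ N') N') (i x) = 0 ↔ grMk N (N ⊓ N') x = 0 := by
    intro x
    rw [grMk_eq_zero_iff, grMk_eq_zero_iff, hi, StrictSub.space_inf]
    exact ⟨fun hx => ⟨subIncl_mem N x, hx⟩, fun hx => hx.2⟩
  -- Generically this is the second isomorphism theorem. On lattices it is only an inclusion,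
  -- because the join is saturated, so the degrees satisfy an inequality.
  let f : (X.gr N (N ⊓ N')).V →ₗ[F] (X.gr (N ⊔ N') N').V :=
    Submodule.liftQ _ (grMk (N ⊔ N') N' ∘ₗ i) fun x hx =>
      (hker x).2 ((Submodule.Quotient.mk_eq_zero _).2 hx)
  have hf : ∀ x, f (grMk N (N ⊓ N') x) = grMk (N ⊔ N') N' (i x) := fun x => rfl
  refine deg_le_deg h (fg_gr hfg _ _) (fg_gr hfg _ _) hr f ?_ ?_ ?_
  · rw [injective_iff_map_eq_zero]
    intro y hy
    obtain ⟨x, rfl⟩ := grMk_surjective _ _ y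
    rwa [hf, hker] at hy
  · intro y
    obtain ⟨x, rfl⟩ := grMk_surjective _ _ y
    rw [← grMk_φ, hf, hf, ← grMk_φ]
    rfl
  · intro y hy
    obtain ⟨x, hx, rfl⟩ := (mem_gr_L _ _ _).1 hy
    rw [hf]
    exact (mem_gr_L _ _ _).2 ⟨i x, (le_sup_left : N ≤ N ⊔ N') hx, rfl⟩

lemma rank_sup_add_rank_inf (hfg : X.L.FG) (N N' : X.StrictSub) :
    (X.sub (N ⊔ N')).rank + (X.sub (N ⊓ N')).rank = (X.sub N).rank + (X.sub N').rank := by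
  have := finiteDimensional_of_fg hfg
  rw [rank_sub_eq hfg, rank_sub_eq hfg, rank_sub_eq hfg, rank_sub_eq hfg, StrictSub.space_sup,
    StrictSub.space_inf]
  exact Submodule.finrank_sup_add_finrank_inf_eq _ _

lemma deg_add_deg_le (h : IsFrobeniusNorm R σ q nrm ϖ) (hfg : X.L.FG) (N N' : X.StrictSub) :
    (X.sub N).deg q nrm ϖ + (X.sub N').deg q nrm ϖ ≤
      (X.sub (N ⊔ N')).deg q nrm ϖ + (X.sub (N ⊓ N')).deg q nrm ϖ := by
  have h1 := rank_add_rank_gr h hfg (inf_le_left : N ⊓ N' ≤ N)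
  have h2 := rank_add_rank_gr h hfg (le_sup_right : N' ≤ N ⊔ N')
  have h3 := deg_gr_inf_le_deg_gr_sup h hfg N N'
    (by have := rank_sup_add_rank_inf hfg N N'; omega)
  linarith [h1.2, h2.2]

lemma strictMono_rank (hfg : X.L.FG) : StrictMono fun N : X.StrictSub => (X.sub N).rank := by
  intro N N' hlt
  have := finiteDimensional_of_fg hfg
  change (X.sub N).rank < (X.sub N').rank
  rw [rank_sub_eq hfg, rank_sub_eq hfg]
  refine Submodule.finrank_lt_finrank_of_lt (lt_of_le_of_ne (StrictSub.le_iff_space_le.1 hlt.le) ?_)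
  exact fun heq => hlt.ne (StrictSub.ext_space heq)

lemma rank_sub_bot (hfg : X.L.FG) : (X.sub ⊥).rank = 0 := by
  rw [rank_sub_eq hfg, StrictSub.space_bot, finrank_bot]

lemma rank_sub_top_and_deg_sub_top (h : IsFrobeniusNorm R σ q nrm ϖ) (hfg : X.L.FG) :
    (X.sub ⊤).rank = X.rank ∧ (X.sub ⊤).deg q nrm ϖ = X.deg q nrm ϖ := by
  refine deg_eq_deg h (fg_sub hfg _) hfg (LinearEquiv.ofBijective (subIncl ⊤)
    ⟨subIncl_injective _, fun x => exists_subIncl_eq _ ?_⟩) (fun x => rfl) fun x => Iff.rfl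
  rw [StrictSub.space_top]
  trivial

lemma deg_sub_bot (h : IsFrobeniusNorm R σ q nrm ϖ) (hfg : X.L.FG) :
    (X.sub ⊥).deg q nrm ϖ = 0 := by
  obtain ⟨b, A, hA⟩ := exists_isFrobMatrix (fg_sub hfg (⊥ : X.StrictSub))
  have : IsEmpty (Fin (X.sub ⊥).rank) := by
    rw [rank_sub_bot hfg]
    infer_instance
  rw [deg_eq h hA, Matrix.det_isEmpty, h.map_one, Real.logb_one]

end PhiModule


/-! ## Subobjects of subquotients and semi-stability -/

namespace PhiModule

universe uR uF uV

variable {R : Type uR} {F : Type uF} [CommRing R] [IsDomain R] [Field F] [Algebra R F]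
  [IsFractionRing R F] {σ : F →+* F} {q : ℕ} {nrm : F → ℝ} {ϖ : F}
  {X : PhiModule.{uR, uF, uV} R F σ}

/-- The strict subobject `S` of `N/N'` corresponds to the strict subobject `M` of `X`. -/
def Corresponds {N N' : X.StrictSub} (S : (X.gr N N').StrictSub) (M : X.StrictSub) : Prop :=
  ∀ x, grMk N N' x ∈ S.space ↔ subIncl N x ∈ M.space

lemma exists_corresponds_of_sub {N N' : X.StrictSub} (hle : N' ≤ N)
    (S : (X.gr N N').StrictSub) :
    ∃ M, N' ≤ M ∧ M ≤ N ∧ Corresponds S M := by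
  let W : Submodule F X.V := (S.space.comap (grMk N N')).map (subIncl N)
  have hW : ∀ x, subIncl N x ∈ W ↔ grMk N N' x ∈ S.space := fun x =>
    ⟨fun ⟨y, hy, hyx⟩ => subIncl_injective N hyx ▸ hy, fun hx => ⟨x, hx, rfl⟩⟩
  have hWN : W ≤ N.space := by
    rintro _ ⟨y, -, rfl⟩
    exact subIncl_mem N y
  have hst : X.IsStable W := by
    intro x
    by_cases hx : x ∈ N.space
    · obtain ⟨x, rfl⟩ := exists_subIncl_eq N hx
      rw [← subIncl_φ, hW, hW, grMk_φ]
      exact S.isStable_space _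
    -- Outside the span of `N` neither `x` nor `φ x` can lie in `W`, by stability of `N`.
    · exact iff_of_false (fun h => hx ((N.isStable_space x).1 (hWN h))) fun h => hx (hWN h)
  refine ⟨StrictSub.ofSpace W hst, ?_, ?_, ?_⟩
  · rw [StrictSub.le_iff_space_le, StrictSub.space_ofSpace]
    intro x hx
    obtain ⟨x, rfl⟩ := exists_subIncl_eq N (StrictSub.le_iff_space_le.1 hle hx)
    rw [hW, (grMk_eq_zero_iff N N' x).2 hx]
    exact zero_mem _
  · rwa [StrictSub.le_iff_space_le, StrictSub.space_ofSpace]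
  · intro x
    rw [StrictSub.space_ofSpace, hW]

lemma exists_corresponds_of_le {N N' M : X.StrictSub} (h1 : N' ≤ M) :
    ∃ S : (X.gr N N').StrictSub, Corresponds S M := by
  let W : Submodule F (X.gr N N').V := (M.space.comap (subIncl N)).map (grMk N N')
  have hW : ∀ x, grMk N N' x ∈ W ↔ subIncl N x ∈ M.space := by
    refine fun x => ⟨fun ⟨y, hy, hyx⟩ => ?_, fun hx => ⟨x, hx, rfl⟩⟩
    have h3 : subIncl N (x - y) ∈ M.space :=
      StrictSub.le_iff_space_le.1 h1 ((grMk_eq_zero_iff N N' _).1 (by rw [map_sub, hyx, sub_self]))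
    rw [map_sub] at h3
    exact (Submodule.sub_mem_iff_left _ hy).1 h3
  have hst : (X.gr N N').IsStable W := by
    intro y
    obtain ⟨x, rfl⟩ := grMk_surjective N N' y
    rw [← grMk_φ, hW, hW, subIncl_φ]
    exact M.isStable_space _
  exact ⟨StrictSub.ofSpace W hst, fun x => by rw [StrictSub.space_ofSpace, hW]⟩

variable [ValuationRing R]

/-- The map `M/N' → S` is an isomorphism of lattices: a lift to `N` of an element of `S` lies in the
span of `M`, hence in `M` by saturation. No degree is lost here. -/
lemma Corresponds.rank_eq_and_deg_eq (h : IsFrobeniusNorm R σ q nrm ϖ) (hfg : X.L.FG)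
    {N N' M : X.StrictSub} {S : (X.gr N N').StrictSub} (hS : Corresponds S M)
    (h2 : M ≤ N) :
    (X.gr M N').rank = ((X.gr N N').sub S).rank ∧
      (X.gr M N').deg q nrm ϖ = ((X.gr N N').sub S).deg q nrm ϖ := by
  let i : (X.sub M).V →ₗ[F] (X.sub N).V :=
    Submodule.inclusion (StrictSub.le_iff_space_le.1 h2)
  have hi : ∀ x, subIncl N (i x) = subIncl M x := fun x => rfl
  let g : (X.sub M).V →ₗ[F] ((X.gr N N').sub S).V :=
    LinearMap.codRestrict S.space (grMk N N' ∘ₗ i) fun x => (hS _).2 (subIncl_mem M x)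
  have hg : ∀ x, subIncl S (g x) = grMk N N' (i x) := fun x => rfl
  have hker : ∀ x, g x = 0 ↔ grMk M N' x = 0 := fun x => by
    rw [← map_eq_zero_iff _ (subIncl_injective S), hg, grMk_eq_zero_iff, grMk_eq_zero_iff, hi]
  let f : (X.gr M N').V →ₗ[F] ((X.gr N N').sub S).V :=
    Submodule.liftQ _ g fun x hx => (hker x).2 ((Submodule.Quotient.mk_eq_zero _).2 hx)
  have hf : ∀ x, f (grMk M N' x) = g x := fun x => rfl
  have hinj : Function.Injective f := by
    rw [injective_iff_map_eq_zero]
    intro y hy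
    obtain ⟨x, rfl⟩ := grMk_surjective _ _ y
    rwa [hf, hker] at hy
  have hlift : ∀ y : ((X.gr N N').sub S).V, ∀ z, grMk N N' z = subIncl S y →
      ∃ x, i x = z ∧ g x = y := by
    intro y z hz
    have h3 : subIncl N z ∈ M.space := (hS z).1 (hz ▸ subIncl_mem S y)
    obtain ⟨x, hx⟩ := exists_subIncl_eq M h3
    have hxz : i x = z := subIncl_injective N hx
    exact ⟨x, hxz, subIncl_injective S (by rw [hg, hxz, hz])⟩
  have hsurj : Function.Surjective f := by
    intro y
    obtain ⟨z, hz⟩ := grMk_surjective N N' (subIncl S y)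
    obtain ⟨x, -, hx⟩ := hlift y z hz
    exact ⟨grMk M N' x, hx⟩
  refine deg_eq_deg h (fg_gr hfg _ _) (fg_sub (fg_gr hfg _ _) _)
    (LinearEquiv.ofBijective f ⟨hinj, hsurj⟩) ?_ ?_
  · intro y
    obtain ⟨x, rfl⟩ := grMk_surjective _ _ y
    rfl
  · intro y
    change _ ↔ f y ∈ _
    rw [mem_sub_L, StrictSub.mem_N_iff, mem_gr_L, mem_gr_L]
    constructor
    · rintro ⟨x, hx, rfl⟩
      exact ⟨⟨i x, h2 hx, rfl⟩, subIncl_mem S _⟩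
    · rintro ⟨⟨z, hz, hzy⟩, -⟩
      obtain ⟨x, rfl, hxy⟩ := hlift _ z hzy
      exact ⟨x, (M.mem_N_iff _).2 ⟨N.le hz, subIncl_mem M x⟩, hinj hxy⟩

/-- Semi-stability of `N/N'` in terms of the strict subobjects between `N'` and `N`. -/
lemma isSemistable_gr_iff (h : IsFrobeniusNorm R σ q nrm ϖ) (hfg : X.L.FG) {N N' : X.StrictSub}
    (hle : N' ≤ N) (γ : ℝ) :
    (X.gr N N').IsSemistable q nrm ϖ γ ↔
      (X.sub N).deg q nrm ϖ - (X.sub N').deg q nrm ϖ = γ * ((X.sub N).rank - (X.sub N').rank) ∧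
      ∀ M, N' ≤ M → M ≤ N → (X.sub M).deg q nrm ϖ - (X.sub N').deg q nrm ϖ ≤
        γ * ((X.sub M).rank - (X.sub N').rank) := by
  have key : ∀ M : X.StrictSub, N' ≤ M →
      (X.sub M).deg q nrm ϖ - (X.sub N').deg q nrm ϖ = (X.gr M N').deg q nrm ϖ ∧
      ((X.sub M).rank : ℝ) - (X.sub N').rank = (X.gr M N').rank := fun M hM => by
    obtain ⟨h1, h2⟩ := rank_add_rank_gr h hfg hM
    rw [← h1, ← h2]
    push_cast
    constructor <;> ring
  rw [(key N hle).1, (key N hle).2]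
  refine and_congr Iff.rfl ⟨fun hs M h1 h2 => ?_, fun hs S => ?_⟩
  · obtain ⟨S, hS⟩ := exists_corresponds_of_le (N := N) h1
    obtain ⟨h3, h4⟩ := hS.rank_eq_and_deg_eq h hfg h2
    rw [(key M h1).1, (key M h1).2, h3, h4]
    exact hs S
  · obtain ⟨M, h1, h2, hS⟩ := exists_corresponds_of_sub hle S
    obtain ⟨h3, h4⟩ := hS.rank_eq_and_deg_eq h hfg h2
    have := hs M h1 h2
    rwa [(key M h1).1, (key M h1).2, h3, h4] at this

open Matrix in
/-- The Hodge bound for the degree of a strict subobject. -/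
theorem IsHodgeBasis.deg_sub_le (h : IsFrobeniusNorm R σ q nrm ϖ) {e l C}
    (H : X.IsHodgeBasis q nrm e l C) (N : X.StrictSub) (γ : ℝ) :
    (X.sub N).deg q nrm ϖ - γ * (X.sub N).rank ≤
      ∑ i, max (Real.logb q (nrm (l i)) - γ) 0 := by
  have hfg : X.L.FG := H.isFrobMatrix.isBasis.span_eq ▸ Submodule.fg_span (Set.finite_range e)
  obtain ⟨m, n, b, b', A, B, D, hM, hA, -⟩ := exists_isFrobMatrix_fromBlocks hfg (le_top (a := N))
  have hmem : ∀ j, e j ∈ (⊤ : X.StrictSub).space := fun j => by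
    rw [StrictSub.space_top]
    trivial
  choose e' he' using fun j => exists_subIncl_eq ⊤ (hmem j)
  obtain ⟨P, hP⟩ := hM.isBasis.exists_matrix (c := e') fun j => by
    rw [mem_sub_L, he']
    exact H.isFrobMatrix.isBasis.mem j
  have hb : ∀ j, subIncl ⊤ (b j) ∈ X.L := fun j => hM.isBasis.mem j
  obtain ⟨Q, hQ⟩ := H.isBasis_frob.exists_matrix (c := fun j => X.φ (subIncl ⊤ (b j)))
    fun j => Submodule.subset_span ⟨_, hb j, rfl⟩
  -- `P` expresses the Hodge basis in a basis adapted to `N`, and `Q` expresses φ of the latter in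
  -- the basis `l_i e_i` of `φ(φ^*L)`. The block for `N` inherits the factorisation through
  -- `diagonal l`.
  have hmat : fromBlocks A B 0 D =
      P.map (algebraMap R F) * (diagonal l * Q.map (algebraMap R F)) := by
    refine hM.isBasis.linearIndependent.matrix_ext fun j => subIncl_injective ⊤ ?_
    rw [← hM.map_eq, subIncl_φ, hQ, ← sum_smul_sum_smul, map_sum]
    refine Finset.sum_congr rfl fun i _ => ?_
    rw [map_smul, ← hP, he', smul_smul, diagonal_mul, mul_comm]
  have hA' : A = (P.submatrix Sum.inl id).map (algebraMap R F) * diagonal l *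
      (Q.submatrix id Sum.inl).map (algebraMap R F) := by
    ext i j
    have := congrFun (congrFun hmat (Sum.inl i)) (Sum.inl j)
    rw [fromBlocks_apply₁₁] at this
    rw [this, ← Matrix.mul_assoc]
    rfl
  have hdet := hA.det_ne_zero h
  rw [hA'] at hdet
  obtain ⟨f, hf, hle⟩ := h.exists_det_le _ _ l hdet
  rw [← hA'] at hle hdet
  rw [deg_eq h hA, rank_eq hA.isBasis]
  have hq : (1 : ℝ) < q := by exact_mod_cast h.one_lt
  calc Real.logb q (nrm A.det) - γ * Fintype.card (Fin m)
      ≤ Real.logb q (∏ j, nrm (l (f j))) - γ * Fintype.card (Fin m) :=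
        sub_le_sub_right (Real.logb_le_logb_of_le hq (h.pos _ hdet) hle) _
    _ = ∑ j, (Real.logb q (nrm (l (f j))) - γ) := by
        rw [Real.logb_prod _ _ fun j _ => (h.pos _ (H.ne_zero _)).ne', Finset.sum_sub_distrib,
          Finset.sum_const, Finset.card_univ, nsmul_eq_mul, mul_comm]
    _ ≤ ∑ j, max (Real.logb q (nrm (l (f j))) - γ) 0 :=
        Finset.sum_le_sum fun j _ => le_max_left _ _
    _ = ∑ i ∈ Finset.univ.map ⟨f, hf⟩, max (Real.logb q (nrm (l i)) - γ) 0 := by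
        rw [Finset.sum_map]
        rfl
    _ ≤ _ := Finset.sum_le_sum_of_subset_of_nonneg (Finset.subset_univ _)
        fun i _ _ => le_max_right _ _

theorem isSlopeDatum (h : IsFrobeniusNorm R σ q nrm ϖ) (hfg : X.L.FG) :
    IsSlopeDatum (fun N : X.StrictSub => (X.sub N).rank)
      (fun N : X.StrictSub => (X.sub N).deg q nrm ϖ) where
  strictMono := strictMono_rank hfg
  rk_bot := rank_sub_bot hfg
  rk_sup_add_rk_inf := rank_sup_add_rank_inf hfg
  d_bot := deg_sub_bot h hfg
  d_add_le := deg_add_deg_le h hfg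
  bdd := by
    obtain ⟨e, l, C, H⟩ := exists_isHodgeBasis h hfg
    -- The Hodge bound at `γ = 0` is uniform in `N`.
    exact ⟨_, fun N => by simpa using H.deg_sub_le h N 0⟩

lemma isFarguesFiltration_iff (h : IsFrobeniusNorm R σ q nrm ϖ) (hfg : X.L.FG)
    (G : ℝ → X.StrictSub) :
    X.IsFarguesFiltration q nrm ϖ G ↔
      IsHNFiltration (fun N : X.StrictSub => (X.sub N).rank)
        (fun N : X.StrictSub => (X.sub N).deg q nrm ϖ) G := by
  refine and_congr_right fun hG => forall_congr' fun γ => exists_congr fun N =>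
    and_congr_right fun hN => isSemistable_gr_iff h hfg ?_ γ
  obtain ⟨⟨η, hη, rfl⟩, -⟩ := hN
  exact hG.antitone (le_of_lt hη)

/-- The Fargues filtration exists and is unique. -/
theorem existsUnique_isFarguesFiltration (h : IsFrobeniusNorm R σ q nrm ϖ) (hfg : X.L.FG) :
    ∃! G, X.IsFarguesFiltration q nrm ϖ G := by
  have hd := isSlopeDatum h hfg
  refine ⟨hd.argmax, (isFarguesFiltration_iff h hfg _).2 hd.isHNFiltration_argmax, fun G hG => ?_⟩
  exact ((isFarguesFiltration_iff h hfg G).1 hG).eq_argmax hd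

/-- The Fargues type is non-increasing, it sums to the degree, and its polygon is bounded by the
Hodge bound. -/
theorem antitone_farguesType (h : IsFrobeniusNorm R σ q nrm ϖ) {e l C}
    (H : X.IsHodgeBasis q nrm e l C) :
    Antitone (X.farguesType q nrm ϖ) ∧ ∑ i, X.farguesType q nrm ϖ i = X.deg q nrm ϖ ∧
      ∀ γ, ∑ i, max (X.farguesType q nrm ϖ i - γ) 0 ≤
        ∑ i, max (Real.logb q (nrm (l i)) - γ) 0 := by
  have hfg : X.L.FG := H.isFrobMatrix.isBasis.span_eq ▸ Submodule.fg_span (Set.finite_range e)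
  have hd := isSlopeDatum h hfg
  have hex := (existsUnique_isFarguesFiltration h hfg).exists
  have hG : X.IsFarguesFiltration q nrm ϖ (X.farguesFiltration q nrm ϖ) := by
    rw [farguesFiltration, dif_pos hex]
    exact hex.choose_spec
  rw [isFarguesFiltration_iff h hfg] at hG
  obtain ⟨hrank, hdeg⟩ := rank_sub_top_and_deg_sub_top h hfg
  -- The ranks of `⊤` and `X` agree only propositionally, so the index type is generalised before
  -- substitution.
  have key : ∀ r, (X.sub ⊤).rank = r → ∀ t : Fin r → ℝ,
      t = filtrationType (fun N => (X.sub N).rank) (X.farguesFiltration q nrm ϖ) r →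
      Antitone t ∧ ∑ i, t i = X.deg q nrm ϖ ∧
      ∀ γ, ∑ i, max (t i - γ) 0 ≤ ∑ i, max (Real.logb q (nrm (l i)) - γ) 0 := by
    rintro _ rfl _ rfl
    exact ⟨hG.antitone_filtrationType hd, (hG.sum_filtrationType_eq hd).trans hdeg,
      fun γ => (hG.sum_max_filtrationType hd γ).trans_le (H.deg_sub_le h _ γ)⟩
  exact key _ hrank _ rfl

end PhiModule


/-! ## The Hodge filtration -/

lemma IsNormOfRing.add_le {R F : Type*} [CommRing R] [Field F] [Algebra R F] {nrm : F → ℝ}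
    (h : IsNormOfRing R nrm) {x y : F} {t : ℝ} (ht : 0 ≤ t) (hx : nrm x ≤ t) (hy : nrm y ≤ t) :
    nrm (x + y) ≤ t := by
  by_cases h0 : x + y = 0
  · rwa [h0, h.map_zero]
  have h1 : x + y = ∑ i : Fin 2, ![x, y] i := by simp
  rw [h1] at h0 ⊢
  obtain ⟨i, -, -, hi⟩ := h.exists_sum_le _ h0
  refine hi.trans ?_
  fin_cases i
  · exact hx
  · exact hy

/-- The filtration attached to a finite family of jumps. -/
lemma isRFiltration_of_jumps {ι P : Type*} [Finite ι] [PartialOrder P] [BoundedOrder P]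
    {T : Set ι → P} (hT : Monotone T) (htop : T Set.univ = ⊤) (hbot : T ∅ = ⊥) (l : ι → ℝ) :
    IsRFiltration fun γ => T {i | γ ≤ l i} where
  antitone γ η hγη := hT fun i hi => hγη.trans hi
  exhaustive := by
    obtain ⟨a, ha⟩ := (Set.finite_range l).bddBelow
    refine ⟨a, fun γ hγ => ?_⟩
    rw [← htop]
    exact congrArg T (Set.eq_univ_of_forall fun i => hγ.trans (ha ⟨i, rfl⟩))
  separated := by
    obtain ⟨b, hb⟩ := (Set.finite_range l).bddAbove
    refine ⟨b + 1, fun γ hγ => ?_⟩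
    rw [← hbot]
    refine congrArg T (Set.eq_empty_of_forall_notMem fun i (hi : γ ≤ l i) => ?_)
    linarith [hb ⟨i, rfl⟩]
  left_continuous γ := by
    -- Finitely many jumps leave a gap below `γ`; any `γ'` in this gap works.
    have hev : ∀ᶠ γ' in nhdsWithin γ (Set.Iio γ), ∀ i, γ ≤ l i ∨ l i < γ' := by
      rw [Filter.eventually_all]
      intro i
      by_cases hi : γ ≤ l i
      · exact Filter.Eventually.of_forall fun _ => Or.inl hi
      · exact (eventually_nhdsWithin_of_eventually_nhds (lt_mem_nhds (not_le.1 hi))).mono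
          fun _ h => Or.inr h
    obtain ⟨γ', h1, h2⟩ := (hev.and self_mem_nhdsWithin).exists
    refine ⟨γ', h2, fun η h3 h4 => congrArg T (Set.ext fun i => ⟨fun (hi : η ≤ l i) => ?_,
      fun hi => h4.trans hi⟩)⟩
    rcases h1 i with h5 | h5
    · exact h5
    · linarith

/-- The number of values above `γ` of a non-increasing sequence. -/
lemma Antitone.lt_ncard_iff {r : ℕ} {l : Fin r → ℝ} (hl : Antitone l) (γ : ℝ) (i : Fin r) :
    (i : ℕ) < Set.ncard {j | γ ≤ l j} ↔ γ ≤ l i := by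
  constructor
  · intro h
    by_contra hi
    have h1 : {j | γ ≤ l j} ⊆ (Finset.Iio i : Set (Fin r)) := fun j (hj : γ ≤ l j) => by
      rw [Finset.coe_Iio, Set.mem_Iio]
      by_contra hij
      exact hi (hj.trans (hl (not_lt.1 hij)))
    have h2 := Set.ncard_le_ncard h1 (Finset.finite_toSet _)
    rw [Set.ncard_coe_finset, Fin.card_Iio] at h2
    omega
  · intro h
    have h1 : (Finset.Iic i : Set (Fin r)) ⊆ {j | γ ≤ l j} := fun j hj => by
      rw [Finset.coe_Iic, Set.mem_Iic] at hj
      exact h.trans (hl hj)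
    have h2 := Set.ncard_le_ncard h1 (Set.toFinite _)
    rw [Set.ncard_coe_finset, Fin.card_Iic] at h2
    omega

namespace PhiModule

universe uR uF uV

variable {R : Type uR} {F : Type uF} [CommRing R] [IsDomain R] [Field F] [Algebra R F]
  [IsFractionRing R F] {σ : F →+* F} {q : ℕ} {nrm : F → ℝ} {ϖ : F}
  {X : PhiModule.{uR, uF, uV} R F σ}

/-- In a Hodge basis, `I(γ) φ(φ^*L)` is the direct sum of the `I(γ) l_i e_i`, so membership is
tested on coordinates. -/
lemma IsHodgeBasis.mem_ball_iff (h : IsFrobeniusNorm R σ q nrm ϖ) {e l C}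
    (H : X.IsHodgeBasis q nrm e l C) (γ : ℝ) (c : Fin X.rank → F) :
    ∑ i, c i • e i ∈ X.ballMulFrobLattice q nrm γ ↔
      ∀ i, nrm (c i) ≤ (q : ℝ) ^ (-γ) * nrm (l i) := by
  have hq : (1 : ℝ) < q := by exact_mod_cast h.one_lt
  have hqγ : (0 : ℝ) < (q : ℝ) ^ (-γ) := Real.rpow_pos_of_pos (by positivity) _
  have ht : ∀ i, 0 ≤ (q : ℝ) ^ (-γ) * nrm (l i) := fun i => mul_nonneg hqγ.le (h.nonneg _)
  constructor
  · intro hc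
    have key : ∀ z ∈ X.ballMulFrobLattice q nrm γ, ∃ d : Fin X.rank → F, ∑ i, d i • e i = z ∧
        ∀ i, nrm (d i) ≤ (q : ℝ) ^ (-γ) * nrm (l i) := by
      intro z hz
      induction hz using Submodule.span_induction with
      | mem z hz =>
        obtain ⟨x, hx, y, hy, rfl⟩ := hz
        obtain ⟨a, rfl⟩ := (H.isBasis_frob.mem_iff y).1 hy
        refine ⟨fun i => x * (algebraMap R F (a i) * l i), ?_, fun i => ?_⟩
        · rw [Finset.smul_sum]
          exact Finset.sum_congr rfl fun i _ => by rw [smul_smul, smul_smul, mul_assoc]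
        · rw [h.map_mul, h.map_mul]
          exact mul_le_mul hx (mul_le_of_le_one_left (h.nonneg _) (h.map_algebraMap_le_one _))
            (mul_nonneg (h.nonneg _) (h.nonneg _)) hqγ.le
      | zero => exact ⟨0, by simp, fun i => by rw [Pi.zero_apply, h.map_zero]; exact ht i⟩
      | add x y _ _ hx hy =>
        obtain ⟨d, rfl, hd⟩ := hx
        obtain ⟨d', rfl, hd'⟩ := hy
        exact ⟨d + d', by simp [add_smul, Finset.sum_add_distrib],
          fun i => h.add_le (ht i) (hd i) (hd' i)⟩
      | smul a x _ hx =>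
        obtain ⟨d, rfl, hd⟩ := hx
        refine ⟨fun i => algebraMap R F a * d i, ?_, fun i => ?_⟩
        · rw [Finset.smul_sum]
          exact Finset.sum_congr rfl fun i _ => by rw [mul_smul, algebraMap_smul]
        · rw [h.map_mul]
          exact (mul_le_of_le_one_left (h.nonneg _) (h.map_algebraMap_le_one _)).trans (hd i)
    obtain ⟨d, hd, hd'⟩ := key _ hc
    have hcd : ∀ i, c i = d i := by
      intro i
      have h1 : ∑ i, (c i - d i) • e i = 0 := by
        simp_rw [sub_smul, Finset.sum_sub_distrib, hd, sub_self]
      exact sub_eq_zero.1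
        (Fintype.linearIndependent_iff.1 H.isFrobMatrix.isBasis.linearIndependent _ h1 i)
    exact fun i => hcd i ▸ hd' i
  · intro hc
    refine sum_mem fun i _ => Submodule.subset_span
      ⟨c i / l i, ?_, l i • e i, H.isBasis_frob.mem i, ?_⟩
    · have h1 : nrm (c i) = nrm (c i / l i) * nrm (l i) := by
        rw [← h.map_mul, div_mul_cancel₀ _ (H.ne_zero i)]
      have h2 := hc i
      rw [h1] at h2
      exact le_of_mul_le_mul_right h2 (h.pos _ (H.ne_zero i))
    · rw [smul_smul, div_mul_cancel₀ _ (H.ne_zero i)]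

section ResidueField

variable [IsLocalRing R]

/-- The basis of `k ⊗ L` attached to a Hodge basis. -/
noncomputable def IsHodgeBasis.residueBasis {e l C} (H : X.IsHodgeBasis q nrm e l C) :
    Module.Basis (Fin X.rank) (IsLocalRing.ResidueField R)
      (IsLocalRing.ResidueField R ⊗[R] X.L) :=
  H.isFrobMatrix.isBasis.basis.baseChange _

/-- If `log_q |l_i| ≥ γ`, then `e_i` itself lies in the ball. Otherwise the `i`-th coordinate of any
integral vector of the ball has norm below one and dies in the residue field. -/
lemma IsHodgeBasis.hodgeFiltration_eq (h : IsFrobeniusNorm R σ q nrm ϖ) {e l C}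
    (H : X.IsHodgeBasis q nrm e l C) (γ : ℝ) :
    X.hodgeFiltration q nrm γ = Submodule.span (IsLocalRing.ResidueField R)
      (H.residueBasis '' {i | γ ≤ Real.logb q (nrm (l i))}) := by
  have hq : (1 : ℝ) < q := by exact_mod_cast h.one_lt
  have hqγ : (0 : ℝ) < (q : ℝ) ^ (-γ) := Real.rpow_pos_of_pos (by positivity) _
  set b := H.isFrobMatrix.isBasis.basis
  have hb : ∀ i, H.residueBasis i = (1 : IsLocalRing.ResidueField R) ⊗ₜ[R] b i := fun i =>
    Module.Basis.baseChange_apply _ _ i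
  have hl : ∀ i, γ ≤ Real.logb q (nrm (l i)) ↔ 1 ≤ (q : ℝ) ^ (-γ) * nrm (l i) := by
    intro i
    rw [Real.le_logb_iff_rpow_le hq (h.pos _ (H.ne_zero i)), Real.rpow_neg (by positivity),
      inv_mul_eq_div, le_div_iff₀ (Real.rpow_pos_of_pos (by positivity) _), one_mul]
  rw [hodgeFiltration, Submodule.baseChange_eq_span]
  refine le_antisymm (Submodule.span_le.2 ?_) (Submodule.span_le.2 ?_)
  · rintro _ ⟨x, hx, rfl⟩
    have hx' : ∑ i, algebraMap R F (b.repr x i) • e i ∈ X.ballMulFrobLattice q nrm γ := by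
      have h1 : (x : X.V) = ∑ i, algebraMap R F (b.repr x i) • e i := by
        calc (x : X.V) = X.L.subtype (∑ i, b.repr x i • b i) := by
              rw [b.sum_repr, Submodule.subtype_apply]
          _ = _ := by
              rw [map_sum]
              exact Finset.sum_congr rfl fun i _ => by simp [b]
      rw [← h1]
      exact hx
    rw [H.mem_ball_iff h] at hx'
    rw [SetLike.mem_coe, TensorProduct.mk_apply, ← b.sum_repr x, TensorProduct.tmul_sum]
    refine sum_mem fun i _ => ?_
    rw [← TensorProduct.smul_tmul]
    by_cases hi : γ ≤ Real.logb q (nrm (l i))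
    · have h2 : (b.repr x i • (1 : IsLocalRing.ResidueField R)) ⊗ₜ[R] b i =
          (b.repr x i • (1 : IsLocalRing.ResidueField R)) • H.residueBasis i := by
        rw [hb, TensorProduct.smul_tmul', smul_eq_mul, mul_one]
      rw [h2]
      exact Submodule.smul_mem _ _ (Submodule.subset_span ⟨i, hi, rfl⟩)
    · have h2 : b.repr x i ∈ IsLocalRing.maximalIdeal R := by
        rw [IsLocalRing.mem_maximalIdeal, mem_nonunits_iff]
        intro hu
        rw [hl, not_le] at hi
        have := hx' i
        rw [h.map_isUnit hu] at this
        linarith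
      have h3 : b.repr x i • (1 : IsLocalRing.ResidueField R) = 0 := by
        rw [Algebra.smul_def, mul_one]
        exact (IsLocalRing.residue_eq_zero_iff _).2 h2
      rw [h3, TensorProduct.zero_tmul]
      exact zero_mem _
  · rintro _ ⟨i, hi, rfl⟩
    refine Submodule.subset_span ⟨b i, ?_, (hb i).symm⟩
    have h1 : e i = ∑ j, (Pi.single i 1 : Fin X.rank → F) j • e j := by
      simp [Pi.single_apply, ite_smul]
    change (b i : X.V) ∈ X.ballMulFrobLattice q nrm γ
    rw [IsLatticeBasis.coe_basis, h1, H.mem_ball_iff h]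
    intro j
    rcases eq_or_ne j i with rfl | hji
    · rw [Pi.single_eq_same, h.map_one]
      exact (hl j).1 hi
    · rw [Pi.single_eq_of_ne hji, h.map_zero]
      exact mul_nonneg hqγ.le (h.nonneg _)

lemma IsHodgeBasis.isRFiltration_hodgeFiltration (h : IsFrobeniusNorm R σ q nrm ϖ) {e l C}
    (H : X.IsHodgeBasis q nrm e l C) : IsRFiltration (X.hodgeFiltration q nrm) := by
  have heq : X.hodgeFiltration q nrm = fun γ => Submodule.span (IsLocalRing.ResidueField R)
      (H.residueBasis '' {i | γ ≤ Real.logb q (nrm (l i))}) :=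
    funext (H.hodgeFiltration_eq h)
  rw [heq]
  refine isRFiltration_of_jumps
    (T := fun s => Submodule.span (IsLocalRing.ResidueField R) (H.residueBasis '' s))
    (fun s t hst => Submodule.span_mono (Set.image_mono hst)) ?_ ?_ _
  · rw [Set.image_univ, H.residueBasis.span_eq]
  · simp

/-- The dimension of the `γ`-th step counts the `i` with `log_q |l_i| ≥ γ`. By monotonicity this
count exceeds `i` exactly for `γ` up to `log_q |l_i|`. -/
lemma IsHodgeBasis.hodgeType_eq (h : IsFrobeniusNorm R σ q nrm ϖ) {e l C}
    (H : X.IsHodgeBasis q nrm e l C) (i : Fin X.rank) :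
    X.hodgeType q nrm i = Real.logb q (nrm (l i)) := by
  have hrank : ∀ γ, Module.finrank (IsLocalRing.ResidueField R) (X.hodgeFiltration q nrm γ) =
      Set.ncard {i | γ ≤ Real.logb q (nrm (l i))} := by
    intro γ
    rw [H.hodgeFiltration_eq h, ← Set.ncard_image_of_injective _ H.residueBasis.injective]
    classical
    rw [finrank_span_set_eq_card, Set.ncard_eq_toFinset_card']
    exact (H.residueBasis.linearIndependent.linearIndepOn_id).mono (Set.image_subset_range _ _)
  rw [hodgeType, filtrationType]
  simp_rw [hrank, H.antitone.lt_ncard_iff]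
  exact csSup_Iic

end ResidueField

/-- The Fargues type is bounded by the Hodge type. -/
theorem typeLE_farguesType_hodgeType [ValuationRing R] (h : IsFrobeniusNorm R σ q nrm ϖ)
    (hfg : X.L.FG) : TypeLE (X.farguesType q nrm ϖ) (X.hodgeType q nrm) := by
  obtain ⟨e, l, C, H⟩ := exists_isHodgeBasis h hfg
  obtain ⟨h1, h2, h3⟩ := antitone_farguesType h H
  rw [funext (H.hodgeType_eq h)]
  exact typeLE_of_sum_max_le h1 H.antitone h3 (h2.trans (deg_eq_sum h H))

end PhiModule

/-! ## The tilt -/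

/-- The tilt enters only through this lemma and the valuation ring structure of its ring of
integers. Every power `|-|^c` with `c > 0` has the same unit ball, so the normalisation of `ϖ` alone
fixes the scale. -/
lemma isFrobeniusNorm_tilt (p : ℕ) [Fact p.Prime] (K : Type*) [NormedField K]
    [IsUltrametricDist K] [IsPerfectoidField p K] (f : ℕ) (hf : 1 ≤ f) (ϖ : TiltField p K) (c : ℝ)
    (hc : 0 < c) (hnorm : (p ^ f : ℕ) * tiltNorm p K c (ϖ ^ (p ^ f)) = 1) :
    IsFrobeniusNorm (TiltInt p K) (tiltFrobenius p K f) (p ^ f) (tiltNorm p K c) ϖ where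
  map_mul x y := by
    rw [tiltNorm, map_mul, NNReal.coe_mul, Real.mul_rpow (NNReal.coe_nonneg _) (NNReal.coe_nonneg _)]
    rfl
  map_zero := by
    rw [tiltNorm, map_zero, NNReal.coe_zero, Real.zero_rpow hc.ne']
  pos x hx := Real.rpow_pos_of_pos
    (NNReal.coe_pos.2 (pos_iff_ne_zero.2 ((Valuation.ne_zero_iff _).2 hx))) _
  le_one_iff x := by
    rw [tiltNorm, ← Real.one_rpow c, Real.rpow_le_rpow_iff (NNReal.coe_nonneg _) zero_le_one hc,
      NNReal.coe_le_one, ← Valuation.mem_valuationSubring_iff]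
    exact ⟨fun hx => ⟨⟨x, hx⟩, rfl⟩, by rintro ⟨a, rfl⟩; exact a.2⟩
  one_lt := Nat.one_lt_pow (by omega) (Fact.out : p.Prime).one_lt
  map_frob x := by
    rw [tiltNorm, tiltNorm, tiltFrobenius, iterateFrobenius_def, map_pow, NNReal.coe_pow,
      ← Real.rpow_natCast, ← Real.rpow_natCast, ← Real.rpow_mul (NNReal.coe_nonneg _),
      ← Real.rpow_mul (NNReal.coe_nonneg _), mul_comm]
  map_unif := hnorm

theorem mainTheorem7 (p : ℕ) [Fact p.Prime] (K : Type*) [NormedField K] [IsUltrametricDist K]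
    [IsPerfectoidField p K] (f : ℕ) (hf : 1 ≤ f) (ϖ : TiltField p K) (c : ℝ) (hc : 0 < c)
    (hnorm : (p ^ f : ℕ) * tiltNorm p K c (ϖ ^ (p ^ f)) = 1)
    (M : Type*) [AddCommGroup M] [Module (TiltInt p K) M] [Module.Free (TiltInt p K) M]
    [Module.Finite (TiltInt p K) M]
    (φ : TiltField p K ⊗[TiltInt p K] M →ₛₗ[tiltFrobenius p K f] TiltField p K ⊗[TiltInt p K] M)
    (hφ : Function.Bijective φ) :
    (∃! G, (PhiModule.ofModule M φ hφ).IsFarguesFiltration (p ^ f) (tiltNorm p K c) ϖ G) ∧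
    IsRFiltration ((PhiModule.ofModule M φ hφ).hodgeFiltration (p ^ f) (tiltNorm p K c)) ∧
    TypeLE ((PhiModule.ofModule M φ hφ).farguesType (p ^ f) (tiltNorm p K c) ϖ)
      ((PhiModule.ofModule M φ hφ).hodgeType (p ^ f) (tiltNorm p K c)) := by
  have h := isFrobeniusNorm_tilt p K f hf ϖ c hc hnorm
  have hfg : (PhiModule.ofModule M φ hφ).L.FG := by
    have hrange : (LinearMap.range
        (TensorProduct.mk (TiltInt p K) (TiltField p K) M 1)).FG :=
      Module.Finite.iff_fg.1 inferInstance
    exact hrange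
  obtain ⟨e, l, C, H⟩ := PhiModule.exists_isHodgeBasis h hfg
  exact ⟨PhiModule.existsUnique_isFarguesFiltration h hfg, H.isRFiltration_hodgeFiltration h,
    PhiModule.typeLE_farguesType_hodgeType h hfg⟩
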